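/- **Theorem 9.3 (Main result IV).** *There exists a computable family of encoding functions relative to which the computational Diffie–Hellman (CDH) problem is effectively hard for polynomial-time generic algorithms.* Here the terms have the following meaning. *Encoding functions.* For $n\in\mathbb N^+$, an encoding function into $n$ bitstrings is a bijection $\sigma\colon\{0,1,\dots,2^n-1\}\to\{0,1\}^n$. A family of encoding functions is a sequence $\{\sigma_n\}_{n\in\mathbb N^+}$ in which $\sigma_n$ is an encoding function into $n$ bitstrings. It is computable if some algorithm outputs $\sigma_n(x)$ on every input $(n,x)$ with $n\in\mathbb N^+$ and $0\le x<2^n$. *Generic algorithms.* For $N\le 2^n$ we identify $\mathbb Z_N$ with $\{0,\dots,N-1\}$. A generic algorithm is a probabilistic multi-tape oracle Turing machine, which tosses one fair coin in each step. It receives as input the binary representation of $N$, the prime factorization of $N$, and a list $\sigma(x_1),\dots,\sigma(x_k)$ with $x_1,\dots,x_k\in\mathbb Z_N$. It may query the oracles $add(\sigma(x),\sigma(y))=\sigma(x+y)$ and $inv(\sigma(x))=\sigma(-x)$ for $x,y\in\mathbb Z_N$, each query costing one step; a query that involves a string outside $\sigma(\mathbb Z_N)$ is answered by the empty string. Its output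 $\mathcal A(N;\sigma(x_1),\dots,\sigma(x_k))$ is the binary string on its output tape when it stops. *Enumeration.* Let $\mathcal M_1,\mathcal M_2,\dots$ be any recursive enumeration of all generic algorithms. The $k$-th polynomial-time generic algorithm $\mathcal A_k$ is $\mathcal M_k$ executed for at most $L^k+k$ steps, where $L$ is the length of the input. *Experiment.* Let $\mathcal A$ be a polynomial-time generic algorithm and $\sigma$ an encoding function into $n$ bitstrings. The experiment $\mathsf{CDH}_{\mathcal A}(n,\sigma)$ chooses an $n$-bit prime $p$ (that is, a prime with $2^{n-1}\le p<2^n$) uniformly, and then $x,y\in\mathbb Z_p$ uniformly and independently. Its value is $1$ if $\mathcal A(p;\sigma(1),\sigma(x),\sigma(y))=\sigma(xy)$, with $xy$ computed in $\mathbb Z_p$, and $0$ otherwise. (For $n=1$, where there is no $n$-bit prime, the probability that the value is $1$ is taken to be $0$.) *Effective hardness.* The CDH problem is effectively hard relative to $\{\sigma_n\}_{n\in\mathbb N^+}$ if there is a computable function $f\colon\mathbb N^+\times\mathbb N^+\to\mathbb N^+$ such that, for all $i,d,n\in\mathbb N^+$ with $n\ge f(i,d)$, $$\operatorname{Prob}\left[\mathsf{CDH}_{\mathcal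 A_i}(n,\sigma_n)=1\right]\le\frac1{n^d}.$$ -/

import Mathlib

namespace GenericGroup

/-! ### Encoding functions -/

/-- An encoding function into `n` bitstrings: a bijection from `{0, …, 2 ^ n - 1}` to `{0,1} ^ n`. -/
abbrev EncodingFunction (n : ℕ) : Type := Fin (2 ^ n) ≃ List.Vector Bool n

/-- The string `σ(x)`, for a natural number `x < 2 ^ n`
(the value `[]` for larger `x` is a dummy and is never used below). -/
def word {n : ℕ} (σ : EncodingFunction n) (x : ℕ) : List Bool :=
  if h : x < 2 ^ n then (σ ⟨x, h⟩).toList else []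

/-- A family of encoding functions `{σ_n}`, indexed by the positive integers. -/
abbrev EncodingFamily : Type := ∀ n : ℕ+, EncodingFunction (n : ℕ)

/-- The family is computable: an algorithm computes `σ_n(x)` from `n` and `x < 2 ^ n`. -/
def IsComputableFamily (σ : EncodingFamily) : Prop :=
  ∃ g : ℕ → ℕ → List Bool, Computable₂ g ∧
    ∀ (n : ℕ+) (x : Fin (2 ^ (n : ℕ))), g n x = (σ n x).toList

/-! ### The group oracles -/

/-- The element `x` of `ℤ_N = {0, …, N - 1}` with `σ(x) = w`, if `w` belongs to `σ(ℤ_N)`. -/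
def elementOf {n : ℕ} (σ : EncodingFunction n) (N : ℕ) (w : List Bool) : Option ℕ :=
  (List.range N).find? fun x => decide (word σ x = w)

/-- The oracle `add(σ(x), σ(y)) = σ(x + y)` on `σ(ℤ_N) × σ(ℤ_N)`.
A query outside this set is answered by the empty string. -/
def addOracle {n : ℕ} (σ : EncodingFunction n) (N : ℕ) (u v : List Bool) : List Bool :=
  match elementOf σ N u, elementOf σ N v with
  | some x, some y => word σ ((x + y) % N)
  | _, _ => []

/-- The oracle `inv(σ(x)) = σ(-x)` on `σ(ℤ_N)`.
A query outside this set is answered by the empty string. -/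
def invOracle {n : ℕ} (σ : EncodingFunction n) (N : ℕ) (u : List Bool) : List Bool :=
  match elementOf σ N u with
  | some x => word σ ((N - x) % N)
  | none => []

/-! ### Tapes -/

/-- A one-way infinite tape: the cells to the left of the head (nearest cell first), and the cells
from the scanned one rightwards; all cells not listed are blank.
The symbols are natural numbers: `0` is the blank, `1` and `2` stand for the bits `0` and `1`,
`3` and `4` are the separators of the input format; a machine may use finitely many others. -/
abbrev Tape : Type := List ℕ × List ℕ

namespace Tape

/-- The scanned symbol. -/
def scan (t : Tape) : ℕ := t.2.headD 0

/-- Overwrite the scanned symbol. -/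
def write (s : ℕ) (t : Tape) : Tape := (t.1, s :: t.2.tail)

/-- Move the head: `none` stays, `some true` moves right, and `some false` moves left
(and stays if the head is on the leftmost cell). -/
def move : Option Bool → Tape → Tape
  | none, t => t
  | some true, t => (scan t :: t.1, t.2.tail)
  | some false, ([], r) => ([], r)
  | some false, (s :: l, r) => (l, s :: r)

/-- The symbol standing for a bit. -/
def bitSymbol (b : Bool) : ℕ := if b then 2 else 1

/-- The tape with the given symbols in its first cells and the head on the leftmost cell. -/
def ofSymbols (l : List ℕ) : Tape := ([], l)

/-- The binary string written on the tape: it starts in the leftmost cell and ends before the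
first cell that does not hold a bit. -/
def contents (t : Tape) : List Bool :=
  ((t.1.reverse ++ t.2).takeWhile fun s => decide (s = 1 ∨ s = 2)).map fun s => decide (s = 2)

end Tape

/-! ### Probabilistic oracle Turing machines -/

/-- A line of a transition table. It applies if the machine is in state `state`, the fair coin
tossed in this step shows `coin`, and the symbols scanned on the tapes are `read`. Its effect is
that the machine goes to state `next` and, on the `j`-th tape, writes the symbol and makes the head
move given by the `j`-th entry of `act`. -/
structure Rule where
  state : ℕ
  coin : Bool
  read : List ℕ
  next : ℕ
  act : List (ℕ × Option Bool)

/-- A generic algorithm: a probabilistic multi-tape Turing machine with access to the two group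
oracles, given by its number of work tapes and its finite transition table.

Tape `0` is the input tape, tape `1` the output tape, tapes `2` and `3` are the oracle tapes, and
the others are work tapes. State `0` is the initial state, states `1` and `2` are the states that
query the oracles `add` and `inv`, and state `3` is the state after a query has been answered. -/
structure GenericAlgorithm where
  workTapes : ℕ
  rules : List Rule

/-- Rules are coded by natural numbers through the coding of tuples and lists. -/
def Rule.equivProd : Rule ≃ ℕ × Bool × List ℕ × ℕ × List (ℕ × Option Bool) where
  toFun r := (r.state, r.coin, r.read, r.next, r.act)
  invFun t := ⟨t.1, t.2.1, t.2.2.1, t.2.2.2.1, t.2.2.2.2⟩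
  left_inv _ := rfl
  right_inv _ := rfl

instance : Primcodable Rule := Primcodable.ofEquiv _ Rule.equivProd

/-- Generic algorithms are coded by natural numbers through the coding of pairs and lists. -/
def GenericAlgorithm.equivProd : GenericAlgorithm ≃ ℕ × List Rule where
  toFun A := (A.workTapes, A.rules)
  invFun t := ⟨t.1, t.2⟩
  left_inv _ := rfl
  right_inv _ := rfl

instance : Primcodable GenericAlgorithm := Primcodable.ofEquiv _ GenericAlgorithm.equivProd

/-- A configuration of a machine. -/
structure Config where
  state : ℕ
  tapes : List Tape

namespace Config

/-- The string on the `j`-th tape. -/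
def string (c : Config) (j : ℕ) : List Bool := (c.tapes.getD j ([], [])).contents

/-- An oracle has given the answer `w`: it replaces the contents of tape `2`, and the machine goes
to state `3`. -/
def answer (c : Config) (w : List Bool) : Config where
  state := 3
  tapes := c.tapes.set 2 (Tape.ofSymbols (w.map Tape.bitSymbol))

/-- The effect of a rule on a configuration. -/
def apply (c : Config) (r : Rule) : Config where
  state := r.next
  tapes := c.tapes.mapIdx fun j t =>
    match r.act[j]? with
    | some a => (t.write a.1).move a.2
    | none => t

end Config

namespace GenericAlgorithm

/-- The input tape for the order `N` and the list `ws` of encoded elements: the binary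
representation of `N` (most significant bit first), the prime factors of `N` with multiplicity, and
the strings in `ws`. -/
def inputSymbols (N : ℕ) (ws : List (List Bool)) : List ℕ :=
  let bin (m : ℕ) : List ℕ := m.bits.reverse.map Tape.bitSymbol
  bin N ++ [4]
    ++ N.primeFactorsList.flatMap (fun q => bin q ++ [3]) ++ [4]
    ++ ws.flatMap (fun w => w.map Tape.bitSymbol ++ [3])

/-- The initial configuration: the input is on tape `0`, and the other tapes are blank. -/
def initial (A : GenericAlgorithm) (input : List ℕ) : Config where
  state := 0
  tapes := Tape.ofSymbols input :: List.replicate (3 + A.workTapes) (Tape.ofSymbols [])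

/-- One step of the machine in the group `σ(ℤ_N)`, with the fair coin tossed in this step. An
oracle query costs one step. If no rule applies then nothing changes; in particular, a
configuration in which no rule applies for either coin is a halting configuration. -/
def step {n : ℕ} (A : GenericAlgorithm) (σ : EncodingFunction n) (N : ℕ)
    (c : Config) (coin : Bool) : Config :=
  if c.state = 1 then c.answer (addOracle σ N (c.string 2) (c.string 3))
  else if c.state = 2 then c.answer (invOracle σ N (c.string 2))
  else
    match A.rules.find? fun r =>
      decide (r.state = c.state ∧ r.coin = coin ∧ r.read = c.tapes.map Tape.scan) with
    | some r => c.apply r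
    | none => c

/-- The output `A(N; ws)` of `A` in the group `σ(ℤ_N)` when it is stopped after as many steps as
there are coins, the coin of each step being given: the string on the output tape. -/
def output {n : ℕ} (A : GenericAlgorithm) (σ : EncodingFunction n) (N : ℕ)
    (ws : List (List Bool)) (coins : List Bool) : List Bool :=
  (coins.foldl (A.step σ N) (A.initial (inputSymbols N ws))).string 1

end GenericAlgorithm

/-- `M 1, M 2, M 3, …` is a recursive enumeration of all generic algorithms. -/
def IsRecursiveEnumeration (M : ℕ → GenericAlgorithm) : Prop :=
  Computable M ∧ ∀ A : GenericAlgorithm, ∃ i : ℕ+, M i = A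

/-! ### The computational Diffie–Hellman problem -/

/-- The number of steps, `L ^ k + k`, allowed to the `k`-th polynomial-time generic algorithm on
inputs of length `L`. -/
def timeBound (k L : ℕ) : ℕ := L ^ k + k

/-- The input list `σ(1), σ(x), σ(y)` of a Diffie–Hellman instance. -/
def cdhInstance {n : ℕ} (σ : EncodingFunction n) (x y : ℕ) : List (List Bool) :=
  [word σ 1, word σ x, word σ y]

/-- The number of steps allowed to the `k`-th algorithm on the instance `(N; σ(1), σ(x), σ(y))`. -/
def cdhTime {n : ℕ} (k : ℕ) (σ : EncodingFunction n) (N x y : ℕ) : ℕ :=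
  timeBound k (GenericAlgorithm.inputSymbols N (cdhInstance σ x y)).length

/-- The probability, over the coin tosses, that `A`, stopped after the number of steps that is
allowed to the `k`-th algorithm, outputs `σ(xy)` on input `(N; σ(1), σ(x), σ(y))`. -/
def cdhInstanceProb {n : ℕ} (A : GenericAlgorithm) (k : ℕ) (σ : EncodingFunction n)
    (N x y : ℕ) : ℚ :=
  ((Finset.univ.filter fun r : Fin (cdhTime k σ N x y) → Bool =>
      A.output σ N (cdhInstance σ x y) (List.ofFn r) = word σ (x * y % N)).card : ℚ)
    / 2 ^ cdhTime k σ N x y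

/-- The set of `n`-bit primes. -/
def bitPrimes (n : ℕ) : Finset ℕ := (Finset.Ico (2 ^ (n - 1)) (2 ^ n)).filter Nat.Prime

/-- `Prob[CDH_{A_k}(n, σ) = 1]` where `A_k` is `A` stopped after `L ^ k + k` steps, `L` being the
length of the input: an `n`-bit prime `p` and `x, y ∈ ℤ_p` are chosen uniformly, and `A_k` has to
output `σ(xy)` on input `(p; σ(1), σ(x), σ(y))`. (For `n = 1` there is no `n`-bit prime, and the
value is `0`.) -/
def cdhProb (A : GenericAlgorithm) (k : ℕ) (n : ℕ) (σ : EncodingFunction n) : ℚ :=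
  (∑ p ∈ bitPrimes n,
    (∑ x ∈ Finset.range p, ∑ y ∈ Finset.range p, cdhInstanceProb A k σ p x y) / (p : ℚ) ^ 2)
    / ((bitPrimes n).card : ℚ)

/-- The computational Diffie–Hellman problem is effectively hard relative to the family `σ`, with
respect to the enumeration of the polynomial-time generic algorithms whose `i`-th member is
`M i` stopped after `L ^ i + i` steps on inputs of length `L`. -/
def CDHEffectivelyHard (M : ℕ → GenericAlgorithm) (σ : EncodingFamily) : Prop :=
  ∃ f : ℕ → ℕ → ℕ, Computable₂ f ∧
    ∀ i d n : ℕ+, f i d ≤ n → cdhProb (M i) i n (σ n) ≤ 1 / ((n : ℕ) : ℚ) ^ (d : ℕ)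

end GenericGroup

/-!
The Diffie–Hellman problem is hard relative to a computable family because a random encoding
function is hard for each single algorithm, by a margin which is so wide that one encoding function
is hard for many algorithms at once; such a function can then be found by a search.

*The generic group bound.* Fix a prime `p`, a machine and its coins, and let `σ : V ≃ W` and the
point `d = (x, y)` of `D = ℤ_p ^ 2` be uniform. All that the machine learns is kept in a transcript,
a finite set of pairs `(F, w)` of a form `F : D → V` and a string `w`, which asserts that
`σ (F d) = w`. A form is affine, `a + b x + c y`, or a constant outside `ℤ_p`. As long as different
forms have different strings, a transcript says almost nothing on `d`: for any two points at which
its forms take different values, the same number of bijections agree with it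
(`card_bijections_le`). Two different forms agree at `2 p` points at most, and so do a form and
`x y`, hence a collision or a correct guess of the form of the answer is rare
(`successBound_of_mem`). A string which the machine makes up is no obstacle: its preimage under `σ`
is revealed as a constant form, which never causes a collision (`SuccessBound.reveal`). An induction
on the coins (`SuccessBound.run`) shows that a run of `t` steps succeeds with probability
`O(t ^ 2 / p)` (`card_success_le`).

*One encoding function for many algorithms.* An algorithm enters the competition at `n` when `n`
exceeds its code and a bound beyond which the above probability is below `1 / n ^ (d + 1)`. There
are at most `n` algorithms in it, so averaging over `σ` gives an encoding function that resists all
of them (`exists_resists`). This does not depend on the enumeration `M`, which only enters the bound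
`f`, through the codes of its members.

*Computability.* With an encoding function given as the list of its values, the number of instances
and coins on which a machine succeeds is primitive recursive, because so is each step of a machine
(`primrec_tableStep`, `primrec_tableCount`). Hence resistance is decidable, and an unbounded search
for a resistant table is a computable function of `n` (`exists_computable_resists`).
-/

namespace GenericGroup

/-! ### Hidden bijections and transcripts -/

section Transcripts

open Finset Classical

variable {D V W : Type*}

/-- A collision-free transcript with forms in `𝓕`: different forms have different strings, and a
form has only one string. -/
structure IsTranscript (𝓕 : Set (D → V)) (T : Finset ((D → V) × W)) : Prop where
  forms : ∀ q ∈ T, q.1 ∈ 𝓕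
  injOn_fst : Set.InjOn Prod.fst (T : Set ((D → V) × W))
  injOn_snd : Set.InjOn Prod.snd (T : Set ((D → V) × W))

variable {𝓕 : Set (D → V)} {T : Finset ((D → V) × W)} {S m : ℕ}

theorem IsTranscript.insert [DecidableEq ((D → V) × W)] (hT : IsTranscript 𝓕 T)
    {F : D → V} {w : W} (hF : F ∈ 𝓕) (hFT : ∀ q ∈ T, q.1 ≠ F) (hw : ∀ q ∈ T, q.2 ≠ w) :
    IsTranscript 𝓕 (insert (F, w) T) := by
  have h : (F, w) ∉ (T : Set ((D → V) × W)) := fun h => hw _ h rfl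
  refine ⟨by simpa using ⟨hF, fun a b => hT.forms (a, b)⟩, ?_, ?_⟩
  · rw [coe_insert, Set.injOn_insert h]
    exact ⟨hT.injOn_fst, fun ⟨q, hq, e⟩ => hFT q hq e⟩
  · rw [coe_insert, Set.injOn_insert h]
    exact ⟨hT.injOn_snd, fun ⟨q, hq, e⟩ => hw q hq e⟩

variable [Fintype D]

/-- Two different forms have the same value at no more than `m` points. -/
def FewAgreements (𝓕 : Set (D → V)) (m : ℕ) : Prop :=
  ∀ F ∈ 𝓕, ∀ G ∈ 𝓕, F ≠ G → #{d | F d = G d} ≤ m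

/-- A transcript with `s` entries has colliding forms at no more than `s ^ 2 * m` points. -/
theorem card_le_card_injOn_add (h𝓕 : FewAgreements 𝓕 m) (hT : IsTranscript 𝓕 T) :
    Fintype.card D ≤ #{d : D | Set.InjOn (fun q : (D → V) × W => q.1 d) T} + #T ^ 2 * m := by
  rw [← card_univ, ← card_filter_add_card_filter_not (s := (univ : Finset D))
    (fun d => Set.InjOn (fun q : (D → V) × W => q.1 d) T)]
  gcongr
  calc _ ≤ #(T.offDiag.biUnion fun r => {d | r.1.1 d = r.2.1 d}) := by
        refine card_le_card fun d hd => ?_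
        simp only [mem_filter, mem_univ, true_and, Set.InjOn, not_forall] at hd
        obtain ⟨q, hq, q', hq', h, hne⟩ := hd
        exact mem_biUnion.2 ⟨(q, q'), mem_offDiag.2 ⟨hq, hq', hne⟩, by simpa using h⟩
    _ ≤ #T.offDiag * m := by
        refine card_biUnion_le_card_mul _ _ _ fun r hr => ?_
        obtain ⟨h1, h2, h3⟩ := mem_offDiag.1 hr
        exact h𝓕 _ (hT.forms _ h1) _ (hT.forms _ h2) fun h => h3 (hT.injOn_fst h1 h2 h)
    _ ≤ _ := by
        gcongr
        rw [offDiag_card, sq]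
        exact Nat.sub_le _ _

variable [Fintype V] [Fintype W]

/-- The pairs of a hidden bijection `σ` and a hidden point `d` that agree with a transcript: each
entry `(F, w)` of it asserts that `σ (F d) = w`. -/
noncomputable def consistent (T : Finset ((D → V) × W)) : Finset ((V ≃ W) × D) :=
  univ.filter fun ω => ∀ q ∈ T, ω.1 (q.1 ω.2) = q.2

/-- Conditionally on the transcript `T`, the event `E` has probability at most
`k * (2 * S * m) / |D|`. Here `S` bounds the number of entries of all transcripts in question, `m`
the number of points at which two forms agree, and `k` counts the occasions for an unlikely
agreement. -/
def SuccessBound (S m : ℕ) (T : Finset ((D → V) × W)) (E : (V ≃ W) × D → Prop) (k : ℕ) : Prop :=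
  #{ω ∈ consistent T | E ω} * Fintype.card D ≤ k * (2 * S * m) * #(consistent T)

theorem mem_consistent {T : Finset ((D → V) × W)} {ω : (V ≃ W) × D} :
    ω ∈ consistent T ↔ ∀ q ∈ T, ω.1 (q.1 ω.2) = q.2 := by
  simp [consistent]

theorem mem_consistent_insert {T : Finset ((D → V) × W)} {q : (D → V) × W} {ω : (V ≃ W) × D} :
    ω ∈ consistent (insert q T) ↔ ω.1 (q.1 ω.2) = q.2 ∧ ω ∈ consistent T := by
  simp [mem_consistent]

theorem SuccessBound.congr {E E' : (V ≃ W) × D → Prop} {k : ℕ}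
    (h : ∀ ω ∈ consistent T, (E ω ↔ E' ω)) (hE : SuccessBound S m T E' k) :
    SuccessBound S m T E k := by
  unfold SuccessBound at *
  rwa [filter_congr h]

theorem SuccessBound.mono {E : (V ≃ W) × D → Prop} {k l : ℕ} (hkl : k ≤ l)
    (hE : SuccessBound S m T E k) : SuccessBound S m T E l :=
  hE.trans (by gcongr)

/-- The bijections agreeing with `T` at the point `d` are at least as many as those agreeing with
it at `d'`, if the forms of `T` take different values at `d`: a permutation of `V` carries the
values at `d` to those at `d'`. -/
theorem card_bijections_le (hT : IsTranscript 𝓕 T) {d : D}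
    (hd : Set.InjOn (fun q : (D → V) × W => q.1 d) T) (d' : D) :
    #{σ : V ≃ W | ∀ q ∈ T, σ (q.1 d') = q.2} ≤ #{σ : V ≃ W | ∀ q ∈ T, σ (q.1 d) = q.2} := by
  by_cases hd' : Set.InjOn (fun q : (D → V) × W => q.1 d') T
  · obtain ⟨π, hπ⟩ : ∃ π : V ≃ V, ∀ q ∈ T, π (q.1 d) = q.1 d' := by
      let e : {v // v ∈ T.image fun q => q.1 d} ≃ {v // v ∈ T.image fun q => q.1 d'} :=
        (((Equiv.Set.imageOfInjOn _ _ hd).symm.trans (Equiv.Set.imageOfInjOn _ _ hd')) :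
          _ ≃ _) |> fun f => (Equiv.subtypeEquivRight (by simp)).trans
            (f.trans (Equiv.subtypeEquivRight (by simp)))
      refine ⟨e.extendSubtype, fun q hq => ?_⟩
      rw [Equiv.extendSubtype_apply_of_mem e _ (mem_image_of_mem _ hq)]
      have : (Equiv.Set.imageOfInjOn _ _ hd).symm ⟨q.1 d, ⟨q, hq, rfl⟩⟩ = ⟨q, hq⟩ := by
        rw [Equiv.symm_apply_eq]; rfl
      simp only [e, Equiv.trans_apply]
      erw [this]
      rfl
    refine card_le_card_of_injOn (fun σ => π.trans σ) (fun σ hσ => ?_) ?_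
    · simp only [coe_filter, mem_univ, true_and, Set.mem_ofPred_eq] at hσ ⊢
      intro q hq
      simp [hπ q hq, hσ q hq]
    · intro σ _ τ _ h
      have := congrArg (fun e => π.symm.trans e) h
      simpa [← Equiv.trans_assoc] using this
  · -- Two forms with the same value at `d'` would need the same string.
    rw [card_eq_zero.2]
    · exact Nat.zero_le _
    · refine filter_eq_empty_iff.2 fun σ _ hσ => hd' fun q hq q' hq' h => ?_
      refine hT.injOn_snd hq hq' ?_
      rw [← hσ q hq, ← hσ q' hq']
      exact congrArg σ h

theorem card_consistent_filter (T : Finset ((D → V) × W)) (B : Finset D) :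
    #{ω ∈ consistent T | ω.2 ∈ B} = ∑ d ∈ B, #{σ : V ≃ W | ∀ q ∈ T, σ (q.1 d) = q.2} := by
  rw [card_eq_sum_card_fiberwise (f := Prod.snd) (t := B)
    (fun ω hω => by simpa using (mem_filter.1 hω).2)]
  refine sum_congr rfl fun d hd => ?_
  refine card_bij' (fun ω _ => ω.1) (fun σ _ => (σ, d)) ?_ ?_ ?_ ?_
  · rintro ⟨σ, e⟩ h
    simp only [mem_filter, mem_consistent] at h
    obtain ⟨⟨h, -⟩, rfl⟩ := h
    simpa using h
  · intro σ h
    simp only [mem_filter, mem_univ, true_and] at h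
    simp [mem_consistent, hd]
    simpa using h
  · rintro ⟨σ, e⟩ h
    simp only [mem_filter] at h
    simp [h.2]
  · intros; rfl

theorem card_consistent_mul_le (hT : IsTranscript 𝓕 T) (B : Finset D) :
    #{ω ∈ consistent T | ω.2 ∈ B} * #{d : D | Set.InjOn (fun q : (D → V) × W => q.1 d) T}
      ≤ #B * #(consistent T) := by
  set I : Finset D := {d : D | Set.InjOn (fun q : (D → V) × W => q.1 d) T} with hI
  have h1 : #{ω ∈ consistent T | ω.2 ∈ I} ≤ #(consistent T) := card_filter_le _ _
  refine le_trans ?_ (Nat.mul_le_mul_left _ h1)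
  rw [card_consistent_filter, card_consistent_filter, sum_mul, ← smul_eq_mul, ← sum_const]
  refine sum_le_sum fun b _ => ?_
  rw [mul_comm, ← smul_eq_mul, ← sum_const]
  exact sum_le_sum fun d hd => card_bijections_le hT (by simpa [hI] using hd) b

/-- Conditionally on a transcript, the hidden point is nearly uniform. -/
theorem successBound_of_mem (h𝓕 : FewAgreements 𝓕 m)
    (hS : 2 * S ^ 2 * m ≤ Fintype.card D) (hT : IsTranscript 𝓕 T) (hTS : #T ≤ S)
    {B : Finset D} (hB : #B ≤ S * m) {E : (V ≃ W) × D → Prop}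
    (hE : ∀ ω ∈ consistent T, E ω → ω.2 ∈ B) : SuccessBound S m T E 1 := by
  have h1 := card_consistent_mul_le hT B
  have h2 := card_le_card_injOn_add h𝓕 hT
  have h3 : #T ^ 2 * m ≤ S ^ 2 * m := by gcongr
  have h4 : #{ω ∈ consistent T | E ω} ≤ #{ω ∈ consistent T | ω.2 ∈ B} :=
    card_le_card fun ω hω => by
      rw [mem_filter] at hω ⊢
      exact ⟨hω.1, hE _ hω.1 hω.2⟩
  unfold SuccessBound
  set I := #{d : D | Set.InjOn (fun q : (D → V) × W => q.1 d) T}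
  calc _ ≤ #{ω ∈ consistent T | ω.2 ∈ B} * (2 * I) := by gcongr; linarith
    _ = 2 * (#{ω ∈ consistent T | ω.2 ∈ B} * I) := by ring
    _ ≤ 2 * (S * m * #(consistent T)) := by
        exact Nat.mul_le_mul_left _ (h1.trans (Nat.mul_le_mul_right _ hB))
    _ = _ := by ring

/-- A string may be assumed to occur in the transcript: its preimage under the hidden bijection can
be revealed, as a constant form, without causing a collision. -/
theorem SuccessBound.reveal (hconst : ∀ v : V, (fun _ => v) ∈ 𝓕) (hT : IsTranscript 𝓕 T)
    {E : (V ≃ W) × D → Prop} {k : ℕ} (u : W)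
    (h : ∀ T', IsTranscript 𝓕 T' → T ⊆ T' → #T' ≤ #T + 1 → (∃ F, (F, u) ∈ T') →
      SuccessBound S m T' E k) : SuccessBound S m T E k := by
  by_cases hu : ∃ F, (F, u) ∈ T
  · exact h T hT subset_rfl (Nat.le_succ _) hu
  have hu' : ∀ q ∈ T, q.2 ≠ u := fun q hq e => hu ⟨q.1, by rw [← e]; exact hq⟩
  -- Split the hidden pairs according to the preimage `v` of `u`.
  have key (v : V) : SuccessBound S m (insert ((fun _ => v), u) T) E k := by
    by_cases hv : ∀ q ∈ T, q.1 ≠ fun _ => v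
    · exact h _ (hT.insert (hconst v) hv hu') (subset_insert _ _) (card_insert_le _ _)
        ⟨_, mem_insert_self _ _⟩
    · push Not at hv
      obtain ⟨q, hq, e⟩ := hv
      -- The constant form `v` has a string other than `u`, so `v` is not the preimage of `u`.
      have : consistent (insert ((fun _ => v), u) T) = ∅ := by
        refine eq_empty_of_forall_notMem fun ω hω => ?_
        rw [mem_consistent_insert] at hω
        have h2 := mem_consistent.1 hω.2 q hq
        rw [e] at h2
        exact hu' q hq (h2.symm.trans hω.1)
      simp [SuccessBound, this]
  have fib (P : (V ≃ W) × D → Prop) :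
      #{ω ∈ consistent T | P ω}
        = ∑ v : V, #{ω ∈ consistent (insert ((fun _ => v), u) T) | P ω} := by
    rw [card_eq_sum_card_fiberwise (f := fun ω => ω.1.symm u) (t := univ) (fun ω hω => by simp)]
    refine sum_congr rfl fun v _ => congrArg card ?_
    ext ω
    simp only [mem_filter, mem_consistent_insert, Equiv.symm_apply_eq, eq_comm (a := u)]
    tauto
  have fib' := fib fun _ => True
  simp only [filter_true] at fib'
  unfold SuccessBound at *
  rw [fib, fib', sum_mul, mul_sum]
  exact sum_le_sum fun v _ => key v

/-- The string of a form may be assumed to occur in the transcript, at the cost of the event that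
the form collides with one of those in the transcript. -/
theorem SuccessBound.ask (h𝓕 : FewAgreements 𝓕 m)
    (hS : 2 * S ^ 2 * m ≤ Fintype.card D) (hT : IsTranscript 𝓕 T) (hTS : #T ≤ S)
    {E : (V ≃ W) × D → Prop} {k : ℕ} {G : D → V} (hG : G ∈ 𝓕)
    (h : ∀ T', IsTranscript 𝓕 T' → T ⊆ T' → #T' ≤ #T + 1 → (∃ w, (G, w) ∈ T') →
      SuccessBound S m T' E k) : SuccessBound S m T E (k + 1) := by
  by_cases hGT : ∃ w, (G, w) ∈ T
  · exact (h T hT subset_rfl (Nat.le_succ _) hGT).mono (Nat.le_succ _)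
  have hGT' : ∀ q ∈ T, q.1 ≠ G := fun q hq e => hGT ⟨q.2, by rw [← e]; exact hq⟩
  -- The strings that are still free: an answer outside `N` is a collision.
  let N : Finset W := {w | ∀ q ∈ T, q.2 ≠ w}
  have key (w : W) (hw : w ∈ N) : SuccessBound S m (insert (G, w) T) E k :=
    h _ (hT.insert hG hGT' (by simpa [N] using hw)) (subset_insert _ _) (card_insert_le _ _)
        ⟨_, mem_insert_self _ _⟩
  have fib (P : (V ≃ W) × D → Prop) :
      #{ω ∈ consistent T | P ω ∧ ω.1 (G ω.2) ∈ N}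
        = ∑ w ∈ N, #{ω ∈ consistent (insert (G, w) T) | P ω} := by
    rw [card_eq_sum_card_fiberwise (f := fun ω => ω.1 (G ω.2)) (t := N)
      (fun ω hω => (mem_filter.1 hω).2.2)]
    refine sum_congr rfl fun w hw => congrArg card ?_
    ext ω
    simp only [mem_filter, mem_consistent_insert]
    constructor
    · tauto
    · rintro ⟨⟨h1, h2⟩, h3⟩
      exact ⟨⟨h2, h3, h1 ▸ hw⟩, h1⟩
  have hcol : SuccessBound S m T (fun ω => ω.1 (G ω.2) ∉ N) 1 := by
    refine successBound_of_mem (B := T.biUnion fun q => {d | q.1 d = G d}) h𝓕 hS hT hTS ?_ ?_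
    · refine (card_biUnion_le_card_mul _ _ m fun q hq => ?_).trans (by gcongr)
      exact h𝓕 _ (hT.forms q hq) _ hG (hGT' q hq)
    · intro ω hω h
      simp only [N, mem_filter, mem_univ, true_and, not_forall, not_not] at h
      obtain ⟨q, hq, e⟩ := h
      refine mem_biUnion.2 ⟨q, hq, ?_⟩
      rw [← mem_consistent.1 hω q hq] at e
      simpa using e
  have hle : ∑ w ∈ N, #(consistent (insert (G, w) T)) ≤ #(consistent T) := by
    have := fib fun _ => True
    simp only [filter_true, true_and] at this
    rw [← this]
    exact card_filter_le _ _
  have hE : #{ω ∈ consistent T | E ω} ≤ #{ω ∈ consistent T | E ω ∧ ω.1 (G ω.2) ∈ N}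
      + #{ω ∈ consistent T | ω.1 (G ω.2) ∉ N} := by
    refine le_trans (card_le_card fun ω hω => ?_) (card_union_le _ _)
    simp only [mem_union, mem_filter] at hω ⊢
    tauto
  unfold SuccessBound at *
  calc _ ≤ #{ω ∈ consistent T | E ω ∧ ω.1 (G ω.2) ∈ N} * Fintype.card D
      + #{ω ∈ consistent T | ω.1 (G ω.2) ∉ N} * Fintype.card D := by
        rw [← add_mul]; gcongr
    _ ≤ k * (2 * S * m) * #(consistent T) + 1 * (2 * S * m) * #(consistent T) := by
        refine add_le_add ?_ (by simpa using hcol)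
        rw [fib, sum_mul]
        refine le_trans (sum_le_sum fun w hw => key w hw) ?_
        rw [← mul_sum]
        gcongr
    _ = _ := by ring

end Transcripts

/-! ### Affine forms and the group oracles -/

section Forms

open Finset Classical

variable {n p : ℕ} [hp : Fact p.Prime]

/-- A nonzero polynomial `α + β x + γ y + δ x y` has at most `2 p` zeros in `ℤ_p ^ 2`. -/
theorem card_bilinear_zeros_le {α β γ δ : ZMod p} (h : ¬ (α = 0 ∧ β = 0 ∧ γ = 0 ∧ δ = 0)) :
    #{d : ZMod p × ZMod p | α + β * d.1 + γ * d.2 + δ * (d.1 * d.2) = 0} ≤ 2 * p := by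
  by_cases hγδ : γ = 0 ∧ δ = 0
  · obtain ⟨rfl, rfl⟩ := hγδ
    have : ({d : ZMod p × ZMod p | α + β * d.1 + 0 * d.2 + 0 * (d.1 * d.2) = 0} : Finset _)
        ⊆ {-α / β} ×ˢ univ := fun d hd => by
      simp only [mem_filter, mem_univ, true_and, zero_mul, add_zero] at hd
      have hβ : β ≠ 0 := by
        rintro rfl
        simp at hd
        simp [hd] at h
      simp only [mem_product, mem_singleton, mem_univ, and_true]
      rw [eq_div_iff hβ]
      linear_combination hd
    refine (card_le_card this).trans ?_
    simp [ZMod.card]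
    omega
  · have : ({d : ZMod p × ZMod p | α + β * d.1 + γ * d.2 + δ * (d.1 * d.2) = 0} : Finset _)
        ⊆ ({-γ / δ} ×ˢ univ) ∪ univ.image fun x => (x, -(α + β * x) / (γ + δ * x)) :=
        fun d hd => by
      simp only [mem_filter, mem_univ, true_and] at hd
      simp only [mem_union, mem_product, mem_singleton, mem_univ, and_true, mem_image, true_and]
      by_cases h0 : γ + δ * d.1 = 0
      · left
        have hδ : δ ≠ 0 := by
          rintro rfl
          simp at h0
          exact hγδ ⟨h0, rfl⟩
        rw [eq_div_iff hδ]
        linear_combination h0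
      · refine Or.inr ⟨d.1, Prod.ext rfl ?_⟩
        rw [div_eq_iff h0]
        linear_combination -hd
    refine (card_le_card this).trans ((card_union_le _ _).trans ?_)
    refine (add_le_add le_rfl card_image_le).trans ?_
    simp [ZMod.card]
    omega

/-- An element of `ℤ_p` as a number below `2 ^ n`. -/
def residue (hpn : p ≤ 2 ^ n) (a : ZMod p) : Fin (2 ^ n) :=
  ⟨a.val, a.val_lt.trans_le hpn⟩

theorem residue_injective (hpn : p ≤ 2 ^ n) : Function.Injective (residue hpn) := fun _ _ h =>
  ZMod.val_injective p (congrArg Fin.val h)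

/-- What a generic algorithm can know about an element: it is `a + b x + c y`, for known constants,
or a known number that does not represent an element of `ℤ_p`. -/
def forms (hpn : p ≤ 2 ^ n) : Set (ZMod p × ZMod p → Fin (2 ^ n)) :=
  {F | (∃ a b c : ZMod p, F = fun d => residue hpn (a + b * d.1 + c * d.2)) ∨
    ∃ v : Fin (2 ^ n), p ≤ v ∧ F = fun _ => v}

theorem affine_mem_forms (hpn : p ≤ 2 ^ n) (a b c : ZMod p) :
    (fun d => residue hpn (a + b * d.1 + c * d.2)) ∈ forms hpn :=
  Or.inl ⟨a, b, c, rfl⟩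

theorem const_mem_forms (hpn : p ≤ 2 ^ n) (v : Fin (2 ^ n)) : (fun _ => v) ∈ forms hpn := by
  rcases lt_or_ge (v : ℕ) p with h | h
  · refine Or.inl ⟨(v : ℕ), 0, 0, funext fun d => Fin.ext ?_⟩
    simp [residue, ZMod.val_cast_of_lt h]
  · exact Or.inr ⟨v, h, rfl⟩

theorem card_agree_affine (hpn : p ≤ 2 ^ n) {a b c a' b' c' e : ZMod p}
    (h : ¬ (a = a' ∧ b = b' ∧ c = c' ∧ e = 0)) :
    #{d : ZMod p × ZMod p | residue hpn (a + b * d.1 + c * d.2)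
      = residue hpn (a' + b' * d.1 + c' * d.2 + e * (d.1 * d.2))} ≤ 2 * p := by
  have h' : ¬ (a - a' = 0 ∧ b - b' = 0 ∧ c - c' = 0 ∧ -e = 0) := by
    simpa [sub_eq_zero] using h
  refine le_trans (card_le_card fun d hd => ?_) (card_bilinear_zeros_le h')
  simp only [mem_filter, mem_univ, true_and, (residue_injective hpn).eq_iff] at hd ⊢
  linear_combination hd

theorem card_agree_of_ge (hpn : p ≤ 2 ^ n) {v : Fin (2 ^ n)} (hv : p ≤ v)
    (f : ZMod p × ZMod p → ZMod p) : #{d : ZMod p × ZMod p | v = residue hpn (f d)} ≤ 2 * p := by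
  rw [card_eq_zero.2 (filter_eq_empty_iff.2 fun d _ h => ?_)]
  · exact Nat.zero_le _
  · rw [h] at hv
    exact absurd (f d).val_lt (not_lt.2 hv)

theorem fewAgreements_forms (hpn : p ≤ 2 ^ n) : FewAgreements (forms hpn) (2 * p) := by
  rintro F (⟨a, b, c, rfl⟩ | ⟨v, hv, rfl⟩) G (⟨a', b', c', rfl⟩ | ⟨v', hv', rfl⟩) hne
  · have := card_agree_affine hpn (a := a) (b := b) (c := c) (a' := a') (b' := b') (c' := c')
      (e := 0) (by rintro ⟨rfl, rfl, rfl, -⟩; exact hne rfl)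
    simpa using this
  · simpa only [eq_comm] using card_agree_of_ge hpn hv' fun d => a + b * d.1 + c * d.2
  · convert card_agree_of_ge hpn hv fun d => a' + b' * d.1 + c' * d.2
  · have : v ≠ v' := by rintro rfl; exact hne rfl
    simp [this]

/-- The Diffie–Hellman function is not a form: it is quadratic. -/
theorem card_agree_mul (hpn : p ≤ 2 ^ n) {F : ZMod p × ZMod p → Fin (2 ^ n)}
    (hF : F ∈ forms hpn) : #{d | F d = residue hpn (d.1 * d.2)} ≤ 2 * p := by
  rcases hF with ⟨a, b, c, rfl⟩ | ⟨v, hv, rfl⟩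
  · have := card_agree_affine hpn (a := a) (b := b) (c := c) (a' := 0) (b' := 0) (c' := 0)
      (e := 1) (by simp)
    simpa using this
  · exact card_agree_of_ge hpn hv _

end Forms

section Oracles

variable {n : ℕ} (σ : EncodingFunction n) (N : ℕ)

theorem word_val (v : Fin (2 ^ n)) : word σ v = (σ v).toList := by
  simp [word]

theorem length_word {x : ℕ} (hx : x < 2 ^ n) : (word σ x).length = n := by
  simp [word, hx]

theorem elementOf_eq_none (hN : N ≤ 2 ^ n) {w : List Bool} (hw : w.length ≠ n) :
    elementOf σ N w = none := by
  simp only [elementOf, List.find?_eq_none, List.mem_range, decide_eq_true_eq]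
  rintro x hx rfl
  exact hw (length_word σ (hx.trans_le hN))

theorem word_injOn {x y : ℕ} (hx : x < 2 ^ n) (hy : y < 2 ^ n) (h : word σ x = word σ y) :
    x = y := by
  simp only [word, hx, hy, dif_pos] at h
  simpa using σ.injective (List.Vector.toList_injective h)

theorem elementOf_word (hN : N ≤ 2 ^ n) (v : Fin (2 ^ n)) :
    elementOf σ N (word σ v) = if (v : ℕ) < N then some (v : ℕ) else none := by
  split_ifs with h
  · rw [elementOf, List.find?_range_eq_some]
    refine ⟨by simp, by simpa using h, fun j hj => ?_⟩
    simp only [Bool.not_eq_eq_eq_not, Bool.not_true, decide_eq_false_iff_not]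
    intro e
    exact hj.ne (word_injOn σ (hj.trans v.2) v.2 e)
  · simp only [elementOf, List.find?_eq_none, List.mem_range, decide_eq_true_eq]
    intro x hx e
    exact h (word_injOn σ (hx.trans_le hN) v.2 e ▸ hx)

variable {p : ℕ} [hp : Fact p.Prime] (hpn : p ≤ 2 ^ n)

theorem elementOf_residue (a : ZMod p) :
    elementOf σ p (word σ (residue hpn a)) = some a.val := by
  rw [elementOf_word σ p hpn, if_pos]
  · rfl
  · exact a.val_lt

theorem addOracle_residue (a b : ZMod p) :
    addOracle σ p (word σ (residue hpn a)) (word σ (residue hpn b))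
      = word σ (residue hpn (a + b)) := by
  simp only [addOracle, elementOf_residue]
  simp only [residue, ZMod.val_add]

theorem invOracle_residue (a : ZMod p) :
    invOracle σ p (word σ (residue hpn a)) = word σ (residue hpn (-a)) := by
  simp only [invOracle, elementOf_residue]
  simp only [residue, ZMod.neg_val']

end Oracles

/-! ### The generic group bound -/

section Runs

open Finset

variable {n p : ℕ} [hp : Fact p.Prime]

theorem consistent_word {T : Finset ((ZMod p × ZMod p → Fin (2 ^ n)) × List.Vector Bool n)}
    {F : ZMod p × ZMod p → Fin (2 ^ n)} {w : List.Vector Bool n} (h : (F, w) ∈ T)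
    {ω : EncodingFunction n × ZMod p × ZMod p} (hω : ω ∈ consistent T) :
    w.toList = word ω.1 (F ω.2) := by
  rw [word_val, mem_consistent.1 hω _ h]

variable (hpn : p ≤ 2 ^ n) {S : ℕ}
  {T : Finset ((ZMod p × ZMod p → Fin (2 ^ n)) × List.Vector Bool n)}
  {E : EncodingFunction n × ZMod p × ZMod p → Prop} {k : ℕ}

theorem two_mul_sq_mul_le_card {S : ℕ} (hS : 4 * S ^ 2 ≤ p) :
    2 * S ^ 2 * (2 * p) ≤ Fintype.card (ZMod p × ZMod p) := by
  rw [Fintype.card_prod, ZMod.card]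
  calc 2 * S ^ 2 * (2 * p) = 4 * S ^ 2 * p := by ring
    _ ≤ p * p := by gcongr

/-- The answer to an addition query may be assumed to be known in advance. -/
theorem SuccessBound.add (hS : 4 * S ^ 2 ≤ p) (hT : IsTranscript (forms hpn) T)
    (hTS : #T + 3 ≤ S) (u v : List Bool)
    (h : ∀ T' w, IsTranscript (forms hpn) T' → #T' ≤ #T + 3 →
      (∀ ω ∈ consistent T', addOracle ω.1 p u v = w) → SuccessBound S (2 * p) T' E k) :
    SuccessBound S (2 * p) T E (k + 1) := by
  by_cases hu : u.length = n
  swap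
  · refine (h T [] hT (by omega) fun ω _ => ?_).mono (Nat.le_succ _)
    simp [addOracle, elementOf_eq_none ω.1 p hpn hu]
  by_cases hv : v.length = n
  swap
  · refine (h T [] hT (by omega) fun ω _ => ?_).mono (Nat.le_succ _)
    simp [addOracle, elementOf_eq_none ω.1 p hpn hv]
  refine .reveal (const_mem_forms hpn) hT ⟨u, hu⟩ fun T₁ hT₁ _ hc₁ ⟨F, hF⟩ => ?_
  refine .reveal (const_mem_forms hpn) hT₁ ⟨v, hv⟩ fun T₂ hT₂ h₁₂ hc₂ ⟨G, hG⟩ => ?_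
  replace hF := h₁₂ hF
  have wF {T'} (hT' : T₂ ⊆ T') {ω} (hω : ω ∈ consistent T') : u = word ω.1 (F ω.2) :=
    consistent_word (hT' hF) hω
  have wG {T'} (hT' : T₂ ⊆ T') {ω} (hω : ω ∈ consistent T') : v = word ω.1 (G ω.2) :=
    consistent_word (hT' hG) hω
  rcases hT₂.forms _ hF with ⟨a, b, c, rfl⟩ | ⟨z, hz, rfl⟩
  swap
  · refine (h T₂ [] hT₂ (by omega) fun ω hω => ?_).mono (Nat.le_succ _)
    rw [wF subset_rfl hω, addOracle, elementOf_word _ _ hpn, if_neg (not_lt.2 hz)]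
  rcases hT₂.forms _ hG with ⟨a', b', c', rfl⟩ | ⟨z, hz, rfl⟩
  swap
  · refine (h T₂ [] hT₂ (by omega) fun ω hω => ?_).mono (Nat.le_succ _)
    rw [wG subset_rfl hω, addOracle, elementOf_word _ _ hpn, if_neg (not_lt.2 hz)]
    cases elementOf ω.1 p u <;> rfl
  refine .ask (fewAgreements_forms hpn) (two_mul_sq_mul_le_card hS) hT₂ (by omega)
    (affine_mem_forms hpn (a + a') (b + b') (c + c')) fun T₃ hT₃ h₂₃ hc₃ ⟨w, hw⟩ => ?_
  refine h T₃ w.toList hT₃ (by omega) fun ω hω => ?_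
  rw [wF h₂₃ hω, wG h₂₃ hω, addOracle_residue, consistent_word hw hω]
  congr 3
  ring

/-- The answer to an inversion query may be assumed to be known in advance. -/
theorem SuccessBound.inv (hS : 4 * S ^ 2 ≤ p) (hT : IsTranscript (forms hpn) T)
    (hTS : #T + 3 ≤ S) (u : List Bool)
    (h : ∀ T' w, IsTranscript (forms hpn) T' → #T' ≤ #T + 3 →
      (∀ ω ∈ consistent T', invOracle ω.1 p u = w) → SuccessBound S (2 * p) T' E k) :
    SuccessBound S (2 * p) T E (k + 1) := by
  by_cases hu : u.length = n
  swap
  · refine (h T [] hT (by omega) fun ω _ => ?_).mono (Nat.le_succ _)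
    simp [invOracle, elementOf_eq_none ω.1 p hpn hu]
  refine .reveal (const_mem_forms hpn) hT ⟨u, hu⟩ fun T₁ hT₁ _ hc₁ ⟨F, hF⟩ => ?_
  have wF {T'} (hT' : T₁ ⊆ T') {ω} (hω : ω ∈ consistent T') : u = word ω.1 (F ω.2) :=
    consistent_word (hT' hF) hω
  rcases hT₁.forms _ hF with ⟨a, b, c, rfl⟩ | ⟨z, hz, rfl⟩
  swap
  · refine (h T₁ [] hT₁ (by omega) fun ω hω => ?_).mono (Nat.le_succ _)
    rw [wF subset_rfl hω, invOracle, elementOf_word _ _ hpn, if_neg (not_lt.2 hz)]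
  refine .ask (fewAgreements_forms hpn) (two_mul_sq_mul_le_card hS) hT₁ (by omega)
    (affine_mem_forms hpn (-a) (-b) (-c)) fun T₂ hT₂ h₁₂ hc₂ ⟨w, hw⟩ => ?_
  refine h T₂ w.toList hT₂ (by omega) fun ω hω => ?_
  rw [wF h₁₂ hω, invOracle_residue, consistent_word hw hω]
  congr 3
  ring

/-- A fixed string encodes the Diffie–Hellman value with small probability only. -/
theorem SuccessBound.output (hS : 4 * S ^ 2 ≤ p) (hT : IsTranscript (forms hpn) T)
    (hTS : #T + 1 ≤ S) (u : List Bool) :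
    SuccessBound S (2 * p) T (fun ω => u = word ω.1 (residue hpn (ω.2.1 * ω.2.2))) 1 := by
  by_cases hu : u.length = n
  · refine .reveal (const_mem_forms hpn) hT ⟨u, hu⟩ fun T₁ hT₁ _ hc₁ ⟨F, hF⟩ => ?_
    refine successBound_of_mem (fewAgreements_forms hpn) (two_mul_sq_mul_le_card hS) hT₁ (by omega)
      (B := univ.filter fun d => F d = residue hpn (d.1 * d.2)) ?_ fun ω hω e => ?_
    · refine le_trans ?_ (Nat.le_mul_of_pos_left (2 * p) (by omega : 0 < S))
      convert card_agree_mul hpn (hT₁.forms _ hF)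
    · have : u = word ω.1 (F ω.2) := consistent_word hF hω
      rw [this] at e
      simpa using Fin.ext (word_injOn ω.1 (F ω.2).2 (residue hpn _).2 e)
  · refine .mono (Nat.zero_le 1) (.congr (E' := fun _ => False) (fun ω _ => ?_) ?_)
    · simp only [iff_false]
      rintro rfl
      exact hu (length_word _ (residue hpn _).2)
    · simp [SuccessBound]

/-- A run that starts in a given configuration, with given coins, seldom ends with the encoding of
the Diffie–Hellman value on the output tape. -/
theorem SuccessBound.run (hS : 4 * S ^ 2 ≤ p) (A : GenericAlgorithm) (coins : List Bool)
    (c : Config) (hT : IsTranscript (forms hpn) T) (hTS : #T + 3 * coins.length + 1 ≤ S) :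
    SuccessBound S (2 * p) T (fun ω => (coins.foldl (A.step ω.1 p) c).string 1
      = word ω.1 (residue hpn (ω.2.1 * ω.2.2))) (coins.length + 1) := by
  induction coins generalizing c T with
  | nil => simpa using SuccessBound.output hpn hS hT (by simpa using hTS) (c.string 1)
  | cons coin coins ih =>
    simp only [List.length_cons] at hTS
    simp only [List.foldl_cons, List.length_cons]
    by_cases h1 : c.state = 1
    · refine .add hpn hS hT (by omega) (c.string 2) (c.string 3) fun T' w hT' hc hw => ?_
      refine .congr (fun ω hω => ?_) (ih (c.answer w) hT' (by omega))
      rw [GenericAlgorithm.step, if_pos h1, hw ω hω]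
    by_cases h2 : c.state = 2
    · refine .inv hpn hS hT (by omega) (c.string 2) fun T' w hT' hc hw => ?_
      refine .congr (fun ω hω => ?_) (ih (c.answer w) hT' (by omega))
      rw [GenericAlgorithm.step, if_neg h1, if_pos h2, hw ω hω]
    · refine .mono (Nat.le_succ _) ?_
      simp only [GenericAlgorithm.step, if_neg h1, if_neg h2]
      exact ih _ hT (by omega)

/-- For fixed coins, a generic algorithm solves few Diffie–Hellman instances, on the average over
all encoding functions. -/
theorem card_success_le (hpn : p ≤ 2 ^ n) (A : GenericAlgorithm) (coins : List Bool)
    (hp4 : 4 * (3 * coins.length + 4) ^ 2 ≤ p) :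
    #{ω : EncodingFunction n × ZMod p × ZMod p |
        A.output ω.1 p (cdhInstance ω.1 ω.2.1.val ω.2.2.val) coins
          = word ω.1 (ω.2.1.val * ω.2.2.val % p)} * p
      ≤ 4 * (3 * coins.length + 4) ^ 2 * Fintype.card (EncodingFunction n) * p ^ 2 := by
  set S := 3 * coins.length + 4 with hS
  have h0 : IsTranscript (forms hpn)
      (∅ : Finset ((ZMod p × ZMod p → Fin (2 ^ n)) × List.Vector Bool n)) :=
    ⟨by simp, by simp, by simp⟩
  have key : SuccessBound S (2 * p) 
      (∅ : Finset ((ZMod p × ZMod p → Fin (2 ^ n)) × List.Vector Bool n)) (fun ω =>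
      A.output ω.1 p (cdhInstance ω.1 ω.2.1.val ω.2.2.val) coins
          = word ω.1 (ω.2.1.val * ω.2.2.val % p)) (coins.length + 1 + 1 + 1 + 1) := by
    refine .ask (fewAgreements_forms hpn) (two_mul_sq_mul_le_card hp4) h0 (by simp)
      (affine_mem_forms hpn 1 0 0) fun T₁ hT₁ _ hc₁ ⟨w₁, hw₁⟩ => ?_
    rw [card_empty] at hc₁
    refine .ask (fewAgreements_forms hpn) (two_mul_sq_mul_le_card hp4) hT₁ (by omega)
      (affine_mem_forms hpn 0 1 0) fun T₂ hT₂ h₂ hc₂ ⟨w₂, hw₂⟩ => ?_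
    refine .ask (fewAgreements_forms hpn) (two_mul_sq_mul_le_card hp4) hT₂ (by omega)
      (affine_mem_forms hpn 0 0 1) fun T₃ hT₃ h₃ hc₃ ⟨w₃, hw₃⟩ => ?_
    refine .congr (fun ω hω => ?_) (SuccessBound.run hpn hp4 A coins
      (A.initial (GenericAlgorithm.inputSymbols p [w₁.toList, w₂.toList, w₃.toList]))
      hT₃ (by omega))
    have e₁ := consistent_word (h₃ (h₂ hw₁)) hω
    have e₂ := consistent_word (h₃ hw₂) hω
    have e₃ := consistent_word hw₃ hω
    have : Fact (1 < p) := ⟨hp.out.one_lt⟩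
    simp only [residue, zero_mul, one_mul, add_zero, zero_add, ZMod.val_one] at e₁ e₂ e₃
    rw [e₁, e₂, e₃, ← ZMod.val_mul]
    rfl
  have hc : #(consistent (∅ : Finset ((ZMod p × ZMod p → Fin (2 ^ n)) × List.Vector Bool n)))
      = Fintype.card (EncodingFunction n) * p ^ 2 := by
    have : consistent (∅ : Finset ((ZMod p × ZMod p → Fin (2 ^ n)) × List.Vector Bool n)) = univ :=
      by ext; simp [mem_consistent]
    rw [this, card_univ, Fintype.card_prod, Fintype.card_prod, ZMod.card, sq]
  unfold SuccessBound at key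
  have hf : ∀ P : EncodingFunction n × ZMod p × ZMod p → Prop,
      [DecidablePred P] → #{ω | P ω} = 
      #{ω ∈ consistent (∅ : Finset ((ZMod p × ZMod p → Fin (2 ^ n)) × List.Vector Bool n)) | P ω} :=
    fun P _ => by congr 1; ext; simp [mem_consistent]
  rw [hf]
  rw [hc, Fintype.card_prod, ZMod.card] at key
  refine Nat.le_of_mul_le_mul_right ?_ hp.out.pos
  calc _ = _ * (p * p) := by rw [mul_assoc]
    _ ≤ _ := by convert key
    _ ≤ S * (2 * S * (2 * p)) * (Fintype.card (EncodingFunction n) * p ^ 2) := by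
        gcongr
        omega
    _ = _ := by ring

end Runs

/-! ### Averaging over the encoding functions -/

section Averaging

open Finset

/-- The number of steps allowed to the `i`-th algorithm on Diffie–Hellman instances of `n` bits. -/
def instanceTime (i n : ℕ) : ℕ := timeBound i (5 * n + 6)

/-- The number of Diffie–Hellman instances of `n` bits, each with `t` coin tosses, on which `A`
succeeds. -/
def successCount {n : ℕ} (A : GenericAlgorithm) (t : ℕ) (σ : EncodingFunction n) : ℕ :=
  ∑ p ∈ bitPrimes n, ∑ x ∈ range p, ∑ y ∈ range p, #{r : Fin t → Bool |
    A.output σ p (cdhInstance σ x y) (List.ofFn r) = word σ (x * y % p)}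

/-- A sufficient condition for the `i`-th algorithm `A` to have success probability at most
`1 / n ^ d`: the weight `1 / p ^ 2` of an instance is replaced by its upper bound `4 / 4 ^ n`, which
makes this a condition on natural numbers. -/
def Resists {n : ℕ} (σ : EncodingFunction n) (i d : ℕ) (A : GenericAlgorithm) : Prop :=
  successCount A (instanceTime i n) σ * (4 * n ^ d)
    ≤ 4 ^ n * 2 ^ instanceTime i n * #(bitPrimes n)

theorem mem_bitPrimes {n p : ℕ} : p ∈ bitPrimes n ↔ (2 ^ (n - 1) ≤ p ∧ p < 2 ^ n) ∧ p.Prime := by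
  simp [bitPrimes]

theorem two_pow_le_two_mul {n p : ℕ} (hp : p ∈ bitPrimes n) : 2 ^ n ≤ 2 * p := by
  have := (mem_bitPrimes.1 hp).1.1
  cases n with
  | zero => have := (mem_bitPrimes.1 hp).2.one_lt; simp; omega
  | succ n => rw [Nat.add_sub_cancel] at this; rw [pow_succ]; omega

theorem length_bits {n p : ℕ} (hp : p ∈ bitPrimes n) : p.bits.length = n := by
  obtain ⟨⟨h1, h2⟩, hp⟩ := mem_bitPrimes.1 hp
  rw [Nat.size_eq_bits_len]
  refine le_antisymm (Nat.size_le.2 h2) ?_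
  cases n with
  | zero => exact Nat.zero_le _
  | succ n => exact Nat.lt_size.2 h1

theorem inputSymbols_prime {p : ℕ} (hp : p.Prime) (ws : List (List Bool)) :
    GenericAlgorithm.inputSymbols p ws = p.bits.reverse.map Tape.bitSymbol ++ [4]
      ++ (p.bits.reverse.map Tape.bitSymbol ++ [3]) ++ [4]
      ++ ws.flatMap (fun w => w.map Tape.bitSymbol ++ [3]) := by
  simp [GenericAlgorithm.inputSymbols, Nat.primeFactorsList_prime hp]

theorem cdhTime_eq {n p x y : ℕ} (hp : p ∈ bitPrimes n) (i : ℕ) (σ : EncodingFunction n)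
    (hx : x < p) (hy : y < p) : cdhTime i σ p x y = instanceTime i n := by
  obtain ⟨⟨h1, h2⟩, hp'⟩ := mem_bitPrimes.1 hp
  rw [cdhTime, instanceTime, inputSymbols_prime hp']
  congr 1
  simp [length_bits hp, cdhInstance, length_word σ (hx.trans h2), length_word σ (hy.trans h2),
    length_word σ (hp'.one_lt.trans h2)]
  ring

theorem cdhProb_le {n : ℕ} (hn : 0 < n) {σ : EncodingFunction n} {i d : ℕ} {A : GenericAlgorithm}
    (h : Resists σ i d A) : cdhProb A i n σ ≤ 1 / (n : ℚ) ^ d := by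
  unfold Resists at h
  generalize ht : instanceTime i n = t at h
  have hle : cdhProb A i n σ
      ≤ ((successCount A t σ : ℚ) / 2 ^ t * (4 / 4 ^ n)) / #(bitPrimes n) := by
    unfold cdhProb
    gcongr
    rw [successCount, Nat.cast_sum, sum_div, sum_mul]
    refine sum_le_sum fun p hp => ?_
    have h2 : (2 : ℚ) ^ n ≤ 2 * p := mod_cast two_pow_le_two_mul hp
    have hp0 : (0 : ℚ) < p := mod_cast (mem_bitPrimes.1 hp).2.pos
    have e : ∑ x ∈ range p, ∑ y ∈ range p, cdhInstanceProb A i σ p x y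
        = ((∑ x ∈ range p, ∑ y ∈ range p, #{r : Fin t → Bool |
            A.output σ p (cdhInstance σ x y) (List.ofFn r) = word σ (x * y % p)} : ℕ) : ℚ)
          / 2 ^ t := by
      rw [Nat.cast_sum, sum_div]
      refine sum_congr rfl fun x hx => ?_
      rw [Nat.cast_sum, sum_div]
      refine sum_congr rfl fun y hy => ?_
      rw [cdhInstanceProb, cdhTime_eq hp i σ (mem_range.1 hx) (mem_range.1 hy), ht]
    rw [e, div_eq_mul_inv _ ((p : ℚ) ^ 2)]
    refine mul_le_mul_of_nonneg_left ?_ (by positivity)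
    rw [inv_eq_one_div, div_le_div_iff₀ (by positivity) (by positivity)]
    calc 1 * (4 : ℚ) ^ n = (2 ^ n) ^ 2 := by rw [← pow_mul, mul_comm n, pow_mul]; norm_num
      _ ≤ (2 * p) ^ 2 := by gcongr
      _ = 4 * p ^ 2 := by ring
  refine hle.trans ?_
  have h' : (successCount A t σ : ℚ) * (4 * n ^ d) ≤ 4 ^ n * 2 ^ t * #(bitPrimes n) := mod_cast h
  have hn' : (0 : ℚ) < n := mod_cast hn
  rcases Nat.eq_zero_or_pos #(bitPrimes n) with h0 | h0
  · rw [h0]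
    simp
  · have h0' : (0 : ℚ) < #(bitPrimes n) := mod_cast h0
    rw [div_le_div_iff₀ h0' (by positivity), div_mul_div_comm, div_mul_eq_mul_div,
      div_le_iff₀ (by positivity)]
    linarith

theorem sum_range_eq_sum_zmod {p : ℕ} [NeZero p] (f : ℕ → ℕ) :
    ∑ x ∈ range p, f x = ∑ x : ZMod p, f x.val := by
  obtain ⟨k, rfl⟩ := Nat.exists_eq_succ_of_ne_zero (NeZero.ne p)
  exact (Fin.sum_univ_eq_sum_range f (k + 1)).symm

open Classical in
/-- The average number of successes over all encoding functions is small. -/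
theorem sum_successCount_le {n t : ℕ} (A : GenericAlgorithm)
    (ht : 8 * (3 * t + 4) ^ 2 ≤ 2 ^ n) :
    ∑ σ : EncodingFunction n, successCount A t σ ≤ #(bitPrimes n) *
      (2 ^ t * (4 * (3 * t + 4) ^ 2 * Fintype.card (EncodingFunction n) * 2 ^ n)) := by
  simp only [successCount]
  rw [sum_comm, ← smul_eq_mul, ← sum_const]
  refine sum_le_sum fun p hp => ?_
  have : Fact p.Prime := ⟨(mem_bitPrimes.1 hp).2⟩
  have hpn : p < 2 ^ n := (mem_bitPrimes.1 hp).1.2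
  have hp2 := two_pow_le_two_mul hp
  have e : ∑ σ : EncodingFunction n, ∑ x ∈ range p, ∑ y ∈ range p, #{r : Fin t → Bool |
        A.output σ p (cdhInstance σ x y) (List.ofFn r) = word σ (x * y % p)}
      = ∑ r : Fin t → Bool, #{ω : EncodingFunction n × ZMod p × ZMod p |
        A.output ω.1 p (cdhInstance ω.1 ω.2.1.val ω.2.2.val) (List.ofFn r)
          = word ω.1 (ω.2.1.val * ω.2.2.val % p)} := by
    simp only [card_filter, sum_range_eq_sum_zmod]
    rw [sum_comm (s := (univ : Finset (Fin t → Bool)))]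
    simp only [Fintype.sum_prod_type]
  have hc : 2 ^ t = #(univ : Finset (Fin t → Bool)) := by simp
  rw [e, hc, ← smul_eq_mul, ← sum_const]
  refine sum_le_sum fun r _ => ?_
  have key := card_success_le hpn.le A (List.ofFn r) (by rw [List.length_ofFn]; omega)
  rw [List.length_ofFn] at key
  refine (Nat.le_of_mul_le_mul_right (key.trans_eq ?_) this.out.pos).trans
    (Nat.mul_le_mul_left (4 * (3 * t + 4) ^ 2 * Fintype.card (EncodingFunction n)) hpn.le)
  ring

/-- The encoding functions that do not resist a given algorithm are less than a fraction `1 / n` of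
all encoding functions, if `n` is large. -/
theorem mul_card_not_resists_lt {n : ℕ} (i d : ℕ) (A : GenericAlgorithm)
    (h : 16 * (3 * instanceTime i n + 4) ^ 2 * n ^ (d + 1) ≤ 2 ^ n)
    [DecidablePred fun σ : EncodingFunction n => ¬ Resists σ i d A] (hn : 0 < n) :
    n * #{σ : EncodingFunction n | ¬ Resists σ i d A} < Fintype.card (EncodingFunction n) := by
  set t := instanceTime i n with ht
  set R := 4 ^ n * 2 ^ t * #(bitPrimes n) with hR
  rcases ({σ : EncodingFunction n | ¬ Resists σ i d A} : Finset _).eq_empty_or_nonempty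
    with h0 | h0
  · rw [h0]
    have : Nonempty (EncodingFunction n) := ⟨Fintype.equivOfCardEq (by simp)⟩
    simpa using Fintype.card_pos
  refine Nat.lt_of_mul_lt_mul_right (a := R) ?_
  have h1 : 1 ≤ n ^ (d + 1) := Nat.one_le_pow _ _ hn
  have h8 : 8 * (3 * t + 4) ^ 2 ≤ 2 ^ n := by
    refine le_trans ?_ h
    calc _ ≤ 16 * (3 * t + 4) ^ 2 * 1 := by omega
      _ ≤ _ := by gcongr
  calc n * #{σ : EncodingFunction n | ¬ Resists σ i d A} * R
      = n * ∑ σ : EncodingFunction n with ¬ Resists σ i d A, R := by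
        rw [sum_const, smul_eq_mul]; ring
    _ < n * ∑ σ : EncodingFunction n with ¬ Resists σ i d A,
          successCount A t σ * (4 * n ^ d) := by
        refine Nat.mul_lt_mul_of_pos_left (sum_lt_sum_of_nonempty h0 fun σ hσ => ?_) hn
        exact not_le.1 (mem_filter.1 hσ).2
    _ ≤ n * ∑ σ : EncodingFunction n, successCount A t σ * (4 * n ^ d) := by
        gcongr
        exact subset_univ _
    _ = n * (4 * n ^ d) * ∑ σ : EncodingFunction n, successCount A t σ := by
        rw [← sum_mul]; ring
    _ ≤ n * (4 * n ^ d) * (#(bitPrimes n) *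
      (2 ^ t * (4 * (3 * t + 4) ^ 2 * Fintype.card (EncodingFunction n) * 2 ^ n))) := by
        gcongr
        exact sum_successCount_le A h8
    _ = (16 * (3 * t + 4) ^ 2 * n ^ (d + 1)) *
          (Fintype.card (EncodingFunction n) * 2 ^ n * 2 ^ t * #(bitPrimes n)) := by ring
    _ ≤ 2 ^ n * (Fintype.card (EncodingFunction n) * 2 ^ n * 2 ^ t * #(bitPrimes n)) := by
        gcongr
    _ = Fintype.card (EncodingFunction n) * R := by
        rw [hR, show 4 ^ n = 2 ^ n * 2 ^ n by rw [← mul_pow]; rfl]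
        ring

theorem pow_le_two_pow {K n : ℕ} (h : 4 ^ K ≤ n) : n ^ K ≤ 2 ^ n := by
  have hn : n ≠ 0 := ((Nat.pow_pos (by norm_num)).trans_le h).ne'
  have hK : 2 * K ≤ Nat.log 2 n := by
    refine Nat.le_log_of_pow_le (by norm_num) ?_
    rwa [pow_mul]
  -- With `s = log n` and `2 K ≤ s`, this gives `(s + 1) * K ≤ 2 ^ s`.
  have key (s : ℕ) : (s + 1) * s ≤ 2 * 2 ^ s := by
    rcases Nat.lt_or_ge s 2 with hs | hs
    · interval_cases s <;> norm_num
    · induction s, hs using Nat.le_induction with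
      | base => norm_num
      | succ s hs ih =>
        rw [pow_succ]
        nlinarith
  calc n ^ K ≤ (2 ^ (Nat.log 2 n + 1)) ^ K := by
        gcongr
        exact (Nat.lt_pow_succ_log_self (by norm_num) n).le
    _ = 2 ^ ((Nat.log 2 n + 1) * K) := by rw [← pow_mul]
    _ ≤ 2 ^ n := by
        refine Nat.pow_le_pow_right (by norm_num) ?_
        have h1 := key (Nat.log 2 n)
        have h2 : 2 ^ Nat.log 2 n ≤ n := Nat.pow_log_le_self 2 hn
        have h3 : (Nat.log 2 n + 1) * (2 * K) ≤ (Nat.log 2 n + 1) * Nat.log 2 n := by gcongr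
        nlinarith

theorem sq_instanceTime_mul_le {i d n : ℕ} (h : 4 ^ (4 * i + d + 7) ≤ n) :
    16 * (3 * instanceTime i n + 4) ^ 2 * n ^ (d + 1) ≤ 2 ^ n := by
  refine le_trans ?_ (pow_le_two_pow h)
  have h7 : 4 ^ 7 ≤ n := le_trans (Nat.pow_le_pow_right (by norm_num) (by omega)) h
  have hi : i ≤ n :=
    (show i ≤ 4 * i + d + 7 by omega).trans ((Nat.lt_pow_self (by norm_num)).le.trans h)
  have h1 : 1 ≤ n ^ (2 * i) := Nat.one_le_pow _ _ (by omega)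
  have ht : 3 * instanceTime i n + 4 ≤ n ^ (2 * i + 2) := by
    have h2 : (5 * n + 6) ^ i ≤ n ^ (2 * i) := by
      rw [pow_mul]
      gcongr
      nlinarith
    calc 3 * instanceTime i n + 4 ≤ 3 * (n ^ (2 * i) + n) + 4 := by
          unfold instanceTime timeBound
          gcongr
      _ ≤ (3 * n + 7) * n ^ (2 * i) := by nlinarith
      _ ≤ n ^ 2 * n ^ (2 * i) := by gcongr; nlinarith
      _ = n ^ (2 * i + 2) := by ring
  calc _ ≤ n ^ 2 * (n ^ (2 * i + 2)) ^ 2 * n ^ (d + 1) := by gcongr; nlinarith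
    _ = _ := by ring

/-- The length of strings from which on the `i`-th algorithm is taken into account with the bound
`1 / n ^ d`, where `a` is the code of `i`, `d` and the algorithm. The power of `4` makes `n` large
enough for the average over the encoding functions, and `a` bounds the number of competitors. -/
def threshold (i d a : ℕ) : ℕ := 4 ^ (4 * i + d + 7) + a

/-- Some encoding function into `n` bitstrings resists all algorithms that are taken into account
at `n`. There are at most `n` of these, as they have codes below `n`. -/
theorem exists_resists (n : ℕ) : ∃ σ : EncodingFunction n,
    ∀ a < n, ∀ q : ℕ × ℕ × GenericAlgorithm, Encodable.decode a = some q →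
      threshold q.1 q.2.1 a ≤ n → Resists σ q.1 q.2.1 q.2.2 := by
  classical
  have hne : Nonempty (EncodingFunction n) := ⟨Fintype.equivOfCardEq (by simp)⟩
  rcases n.eq_zero_or_pos with rfl | hn
  · exact ⟨hne.some, fun a ha => absurd ha (Nat.not_lt_zero a)⟩
  by_contra! hcon
  let bad (a : ℕ) : Finset (EncodingFunction n) :=
    {σ | ∃ q : ℕ × ℕ × GenericAlgorithm, Encodable.decode a = some q ∧
      threshold q.1 q.2.1 a ≤ n ∧ ¬ Resists σ q.1 q.2.1 q.2.2}
  have hbad (a : ℕ) : n * #(bad a) < Fintype.card (EncodingFunction n) := by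
    by_cases ha : ∃ q : ℕ × ℕ × GenericAlgorithm, Encodable.decode a = some q ∧
        threshold q.1 q.2.1 a ≤ n
    · obtain ⟨q, hq, hqn⟩ := ha
      refine lt_of_le_of_lt ?_ (mul_card_not_resists_lt q.1 q.2.1 q.2.2
        (sq_instanceTime_mul_le ((Nat.le_add_right _ _).trans hqn)) hn)
      refine Nat.mul_le_mul_left _ (card_le_card fun σ hσ => ?_)
      simp only [bad, mem_filter, mem_univ, true_and] at hσ ⊢
      obtain ⟨q', hq', -, h⟩ := hσ
      rw [hq] at hq'
      cases hq'
      exact h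
    · have : bad a = ∅ := filter_eq_empty_iff.2 fun σ _ ⟨q, hq, h, _⟩ => ha ⟨q, hq, h⟩
      rw [this]
      simpa using Fintype.card_pos
  have hcover : (univ : Finset (EncodingFunction n)) ⊆ (range n).biUnion bad := fun σ _ => by
    obtain ⟨a, ha, q, hq, h1, h2⟩ := hcon σ
    exact mem_biUnion.2 ⟨a, mem_range.2 ha, mem_filter.2 ⟨mem_univ _, q, hq, h1, h2⟩⟩
  have h1 : Fintype.card (EncodingFunction n) ≤ ∑ a ∈ range n, #(bad a) :=
    (card_le_card hcover).trans card_biUnion_le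
  have h2 : ∑ a ∈ range n, n * #(bad a) < ∑ a ∈ range n, Fintype.card (EncodingFunction n) :=
    sum_lt_sum_of_nonempty (by simpa using hn.ne') fun a _ => hbad a
  rw [← mul_sum, sum_const, card_range, smul_eq_mul] at h2
  exact absurd h1 (not_le.2 (Nat.lt_of_mul_lt_mul_left h2))

end Averaging

/-! ### Primitive recursion and the machine model -/

section PrimrecTools

open Primrec

variable {α β σ : Type*} [Primcodable α] [Primcodable β] [Primcodable σ]

theorem primrec_pow : Primrec₂ fun a b : ℕ => a ^ b :=
  Primrec₂.unpaired'.1 Nat.Primrec.pow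

theorem primrec_find? {f : α → List β} {p : α → β → Bool} (hf : Primrec f) (hp : Primrec₂ p) :
    Primrec fun a => (f a).find? (p a) := by
  have h : Primrec fun a => ((f a).filterMap fun b => bif p a b then some b else none).head? :=
    list_head?.comp (listFilterMap hf (Primrec.cond hp (option_some.comp snd) (const none)))
  refine h.of_eq fun a => ?_
  induction f a with
  | nil => rfl
  | cons b l ih =>
    rw [List.filterMap_cons, List.find?_cons]
    cases p a b <;> simp [ih]

theorem primrec_mapIdx {f : α → List β} {g : α → ℕ × β → σ} (hf : Primrec f) (hg : Primrec₂ g) :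
    Primrec fun a => (f a).mapIdx fun j b => g a (j, b) := by
  have h : Primrec fun a => (f a).foldl (fun acc b => acc ++ [g a (acc.length, b)]) [] :=
    list_foldl (h := fun a q => q.1 ++ [g a (q.1.length, q.2)]) hf (const [])
      (list_concat.comp (fst.comp snd) (hg.comp fst
        (Primrec.pair (list_length.comp (fst.comp snd)) (snd.comp snd))))
  refine h.of_eq fun a => ?_
  induction f a using List.reverseRecOn with
  | nil => rfl
  | append_singleton l b ih =>
    rw [List.foldl_append, ih, List.mapIdx_concat, List.foldl_cons, List.foldl_nil,
      List.length_mapIdx]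

theorem primrec_sum_map {f : α → List β} {g : α → β → ℕ} (hf : Primrec f) (hg : Primrec₂ g) :
    Primrec fun a => ((f a).map (g a)).sum := by
  have h : Primrec fun a => ((f a).map (g a)).foldr (fun x s => x + s) 0 :=
    list_foldr (h := fun _ q => q.1 + q.2) (list_map hf hg) (const 0)
      (nat_add.comp (fst.comp snd) (snd.comp snd))
  exact h.of_eq fun a => List.sum_eq_foldr.symm

theorem primrec_sum_range {f : α → ℕ} {g : α → ℕ → ℕ} (hf : Primrec f) (hg : Primrec₂ g) :
    Primrec fun a => ∑ x ∈ Finset.range (f a), g a x :=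
  (primrec_sum_map (list_range.comp hf) hg).of_eq fun a => by
    simp [Finset.sum, Finset.range, Multiset.range]

theorem primrecRel_forall_lt {R : ℕ → β → Prop} (hR : PrimrecRel R) :
    PrimrecRel fun n b => ∀ x < n, R x b :=
  (hR.forall_mem_list.comp (list_range.comp fst) snd).of_eq (by simp)

theorem primrec_bits : Primrec Nat.bits := by
  have hg : Primrec₂ fun (_ : Unit) (l : List (List Bool)) =>
      some (if l.length = 0 then [] else l.length.bodd :: l.getD l.length.div2 []) := by
    have hl : Primrec fun q : Unit × List (List Bool) => q.2.length := list_length.comp snd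
    exact option_some.comp (Primrec.ite (Primrec.eq.comp hl (const 0)) (const [])
      (list_cons.comp (nat_bodd.comp hl) ((list_getD []).comp snd (nat_div2.comp hl))))
  -- `l` holds the binary representations of all numbers below `l.length`.
  have h := nat_strong_rec (fun (_ : Unit) => Nat.bits) hg fun _ n => by
    rcases Nat.eq_zero_or_pos n with rfl | hn
    · simp
    · have hlt : n.div2 < n := by rw [Nat.div2_val]; omega
      have hb : n.bits = n.bodd :: n.div2.bits := by
        conv_lhs => rw [← Nat.bit_bodd_div2 n]
        refine Nat.bits_append_bit _ _ fun h0 => ?_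
        have := Nat.bodd_add_div2 n
        rw [h0] at this
        cases hc : n.bodd
        · simp [hc] at this; omega
        · rfl
      simp [hn.ne', hb, List.getD, List.getElem?_map, List.getElem?_range hlt]
  exact h.comp (const ()) Primrec.id

theorem primrecPred_prime : PrimrecPred Nat.Prime := by
  have hR : PrimrecRel fun m p : ℕ => m < 2 ∨ ¬ p % m = 0 :=
    (PrimrecRel.comp nat_lt fst (const 2)).or
      (PrimrecRel.comp Primrec.eq (nat_mod.comp snd fst) (const 0)).not
  have h := (PrimrecRel.comp nat_le (const 2) Primrec.id).and
    (hR.forall_lt.comp Primrec.id Primrec.id)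
  refine h.of_eq fun p => ?_
  rw [Nat.prime_def_lt']
  refine and_congr Iff.rfl (forall_congr' fun m => ?_)
  simp only [id, Nat.dvd_iff_mod_eq_zero]
  constructor
  · intro h h2 hm
    exact (h hm).resolve_left (by omega)
  · intro h hm
    rcases Nat.lt_or_ge m 2 with h2 | h2
    · exact Or.inl h2
    · exact Or.inr (h h2 hm)

/-- If a decidable relation relates everything to something, unbounded search provides a computable
choice. -/
theorem exists_computable_of_primrecRel {R : α → β → Prop} (hR : PrimrecRel R)
    (h : ∀ a, ∃ b, R a b) : ∃ f : α → β, Computable f ∧ ∀ a, R a (f a) := by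
  classical
  let g (a : α) (k : ℕ) : Option β :=
    (Encodable.decode k : Option β).bind fun b => if R a b then some b else none
  have hg : Primrec₂ g := option_bind (Primrec.decode.comp snd)
    (Primrec.ite (hR.comp (fst.comp fst) snd) (option_some.comp snd) (const none))
  have hdom (a : α) : (Nat.rfindOpt (g a)).Dom := by
    obtain ⟨b, hb⟩ := h a
    exact Nat.rfindOpt_dom.2 ⟨Encodable.encode b, b, by simp [g, hb]⟩
  refine ⟨fun a => (Nat.rfindOpt (g a)).get (hdom a),
    (Partrec.rfindOpt hg.to_comp).of_eq_tot fun a => Part.get_mem _, fun a => ?_⟩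
  obtain ⟨k, hk⟩ := Nat.rfindOpt_spec (Part.get_mem (hdom a))
  simp only [g, Option.mem_def, Option.bind_eq_some_iff, Option.ite_none_right_eq_some] at hk
  obtain ⟨b, -, hb, e⟩ := hk
  cases e
  exact hb

end PrimrecTools

section Machines

open Primrec

theorem Rule.primrec_state : Primrec Rule.state :=
  fst.comp (of_equiv (e := Rule.equivProd))

theorem Rule.primrec_coin : Primrec Rule.coin :=
  (fst.comp snd).comp (of_equiv (e := Rule.equivProd))

theorem Rule.primrec_read : Primrec Rule.read :=
  (fst.comp (snd.comp snd)).comp (of_equiv (e := Rule.equivProd))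

theorem Rule.primrec_next : Primrec Rule.next :=
  (fst.comp (snd.comp (snd.comp snd))).comp (of_equiv (e := Rule.equivProd))

theorem Rule.primrec_act : Primrec Rule.act :=
  (snd.comp (snd.comp (snd.comp snd))).comp (of_equiv (e := Rule.equivProd))

theorem GenericAlgorithm.primrec_workTapes : Primrec GenericAlgorithm.workTapes :=
  fst.comp (of_equiv (e := GenericAlgorithm.equivProd))

theorem GenericAlgorithm.primrec_rules : Primrec GenericAlgorithm.rules :=
  snd.comp (of_equiv (e := GenericAlgorithm.equivProd))

/-- Configurations are coded by natural numbers through the coding of pairs and lists. -/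
def Config.equivProd : Config ≃ ℕ × List Tape where
  toFun c := (c.state, c.tapes)
  invFun t := ⟨t.1, t.2⟩
  left_inv _ := rfl
  right_inv _ := rfl

instance : Primcodable Config := Primcodable.ofEquiv _ Config.equivProd

theorem Config.primrec_state : Primrec Config.state :=
  fst.comp (of_equiv (e := Config.equivProd))

theorem Config.primrec_tapes : Primrec Config.tapes :=
  snd.comp (of_equiv (e := Config.equivProd))

theorem Config.primrec_mk : Primrec₂ Config.mk :=
  of_equiv_symm (e := Config.equivProd)

theorem Tape.primrec_scan : Primrec Tape.scan :=
  (option_getD.comp (list_head?.comp snd) (const 0)).of_eq fun t => by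
    simp [Tape.scan]

theorem Tape.primrec_write : Primrec₂ Tape.write :=
  Primrec.pair (fst.comp snd) (list_cons.comp fst (list_tail.comp (snd.comp snd)))

theorem Tape.primrec_move : Primrec₂ Tape.move := by
  have hr : Primrec fun q : (Option Bool × Tape) × Bool =>
      ((Tape.scan q.1.2 :: q.1.2.1, q.1.2.2.tail) : Tape) :=
    Primrec.pair (list_cons.comp (Tape.primrec_scan.comp (snd.comp fst))
      (fst.comp (snd.comp fst))) (list_tail.comp (snd.comp (snd.comp fst)))
  have hl : Primrec fun q : (Option Bool × Tape) × Bool =>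
      (List.casesOn q.1.2.1 q.1.2 fun s l => (l, s :: q.1.2.2) : Tape) :=
    list_casesOn (h := fun (q : (Option Bool × Tape) × Bool) (b : ℕ × List ℕ) =>
        ((b.2, b.1 :: q.1.2.2) : Tape))
      (fst.comp (snd.comp fst)) (snd.comp fst)
      (Primrec.pair (snd.comp snd)
        (list_cons.comp (fst.comp snd) (snd.comp (snd.comp (fst.comp fst)))))
  refine (option_casesOn (o := fun q : Option Bool × Tape => q.1) fst snd
    (Primrec.cond snd hr hl).to₂).of_eq ?_
  rintro ⟨_ | _ | _, ⟨_ | _, _⟩⟩ <;> rfl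

theorem Tape.primrec_bitSymbol : Primrec Tape.bitSymbol := dom_bool _

theorem Tape.primrec_contents : Primrec Tape.contents := by
  have h1 : Primrec fun s : ℕ => decide (s = 1 ∨ s = 2) :=
    ((PrimrecRel.comp Primrec.eq Primrec.id (const 1)).or
      (PrimrecRel.comp Primrec.eq Primrec.id (const 2))).decide
  have h2 : Primrec fun s : ℕ => decide (s = 2) :=
    (PrimrecRel.comp Primrec.eq Primrec.id (const 2)).decide
  exact list_map ((list_takeWhile h1).comp (list_append.comp (list_reverse.comp fst) snd))
    (h2.comp snd).to₂

theorem Config.primrec_string : Primrec₂ Config.string :=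
  Tape.primrec_contents.comp
    ((list_getD ([], [])).comp (Config.primrec_tapes.comp fst) snd)

theorem Config.primrec_answer : Primrec₂ Config.answer :=
  Config.primrec_mk.comp (const 3) (list_set.comp (Config.primrec_tapes.comp fst)
    (Primrec.pair (const 2) (Primrec.pair (const [])
      (list_map snd (Tape.primrec_bitSymbol.comp snd).to₂))))

theorem Config.primrec_apply : Primrec₂ Config.apply := by
  refine Config.primrec_mk.comp (Rule.primrec_next.comp snd) ?_
  refine primrec_mapIdx (g := fun (q : Config × Rule) (b : ℕ × Tape) =>
    match q.2.act[b.1]? with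
    | some a => (b.2.write a.1).move a.2
    | none => b.2) (Config.primrec_tapes.comp fst) ?_
  refine (option_casesOn (o := fun q : (Config × Rule) × (ℕ × Tape) => q.1.2.act[q.2.1]?)
    (f := fun q => q.2.2) (g := fun q a => (q.2.2.write a.1).move a.2)
    (list_getElem?.comp (Rule.primrec_act.comp (snd.comp fst)) (fst.comp snd)) (snd.comp snd)
    (Tape.primrec_move.comp (snd.comp snd) (Tape.primrec_write.comp (fst.comp snd)
      (snd.comp (snd.comp fst))))).of_eq fun q => ?_
  dsimp only
  cases q.1.2.act[q.2.1]? <;> rfl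

theorem GenericAlgorithm.primrec_initial : Primrec₂ GenericAlgorithm.initial := by
  refine Config.primrec_mk.comp (const 0) (list_cons.comp (Primrec.pair (const []) snd) ?_)
  refine (list_map (f := fun q : GenericAlgorithm × List ℕ => List.range (3 + q.1.workTapes))
    (g := fun _ _ => Tape.ofSymbols []) (list_range.comp (nat_add.comp (const 3)
      (GenericAlgorithm.primrec_workTapes.comp fst))) (const _)).of_eq fun q => ?_
  simp [List.map_const']

end Machines

/-! ### Simulation from a table of values -/

section Tables

open Primrec

/-- The list of all values of an encoding function. -/
def table {n : ℕ} (σ : EncodingFunction n) : List (List Bool) :=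
  (List.range (2 ^ n)).map (word σ)

/-- The string for the number `x` in a table. -/
def tableWord (L : List (List Bool)) (x : ℕ) : List Bool := L.getD x []

theorem tableWord_table {n : ℕ} (σ : EncodingFunction n) : tableWord (table σ) = word σ := by
  funext x
  by_cases hx : x < 2 ^ n
  · simp [tableWord, table, List.getD, List.getElem?_map, List.getElem?_range hx]
  · simp [tableWord, table, List.getD, word, hx]

/-- `elementOf` in terms of a table. -/
def tableElement (L : List (List Bool)) (N : ℕ) (w : List Bool) : Option ℕ :=
  (List.range N).find? fun x => decide (tableWord L x = w)

/-- `addOracle` in terms of a table. -/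
def tableAdd (L : List (List Bool)) (N : ℕ) (u v : List Bool) : List Bool :=
  ((tableElement L N u).bind fun x => (tableElement L N v).map fun y =>
    tableWord L ((x + y) % N)).getD []

/-- `invOracle` in terms of a table. -/
def tableInv (L : List (List Bool)) (N : ℕ) (u : List Bool) : List Bool :=
  ((tableElement L N u).map fun x => tableWord L ((N - x) % N)).getD []

/-- `GenericAlgorithm.step` in terms of a table. -/
def tableStep (L : List (List Bool)) (N : ℕ) (A : GenericAlgorithm) (c : Config) (coin : Bool) :
    Config :=
  if c.state = 1 then c.answer (tableAdd L N (c.string 2) (c.string 3))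
  else if c.state = 2 then c.answer (tableInv L N (c.string 2))
  else
    ((A.rules.find? fun r =>
      decide (r.state = c.state ∧ r.coin = coin ∧ r.read = c.tapes.map Tape.scan)).map
        c.apply).getD c

variable {n : ℕ} (σ : EncodingFunction n)

theorem tableElement_table (N : ℕ) (w : List Bool) :
    tableElement (table σ) N w = elementOf σ N w := by
  rw [tableElement, tableWord_table, elementOf]

theorem tableAdd_table (N : ℕ) (u v : List Bool) :
    tableAdd (table σ) N u v = addOracle σ N u v := by
  simp only [tableAdd, tableElement_table, tableWord_table, addOracle]
  cases elementOf σ N u <;> cases elementOf σ N v <;> rfl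

theorem tableInv_table (N : ℕ) (u : List Bool) :
    tableInv (table σ) N u = invOracle σ N u := by
  simp only [tableInv, tableElement_table, tableWord_table, invOracle]
  cases elementOf σ N u <;> rfl

theorem tableStep_table (N : ℕ) (A : GenericAlgorithm) :
    tableStep (table σ) N A = A.step σ N := by
  funext c coin
  simp only [tableStep, tableAdd_table, tableInv_table, GenericAlgorithm.step]
  cases A.rules.find? fun r =>
    decide (r.state = c.state ∧ r.coin = coin ∧ r.read = c.tapes.map Tape.scan) <;> rfl

theorem primrec_tableWord : Primrec₂ tableWord := list_getD []

section Composition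

variable {α : Type*} [Primcodable α] {L : α → List (List Bool)} {N : α → ℕ}

theorem primrec_tableElement {w : α → List Bool} (hL : Primrec L) (hN : Primrec N)
    (hw : Primrec w) : Primrec fun a => tableElement (L a) (N a) (w a) :=
  primrec_find? (list_range.comp hN)
    (PrimrecRel.comp Primrec.eq (primrec_tableWord.comp (hL.comp fst) snd) (hw.comp fst)).decide

theorem primrec_tableAdd {u v : α → List Bool} (hL : Primrec L) (hN : Primrec N)
    (hu : Primrec u) (hv : Primrec v) : Primrec fun a => tableAdd (L a) (N a) (u a) (v a) := by
  refine option_getD.comp (option_bind (primrec_tableElement hL hN hu) ?_) (const [])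
  refine option_map ((primrec_tableElement hL hN hv).comp fst) ?_
  exact primrec_tableWord.comp (hL.comp (fst.comp fst))
    (nat_mod.comp (nat_add.comp (snd.comp fst) snd) (hN.comp (fst.comp fst)))

theorem primrec_tableInv {u : α → List Bool} (hL : Primrec L) (hN : Primrec N)
    (hu : Primrec u) : Primrec fun a => tableInv (L a) (N a) (u a) := by
  refine option_getD.comp (option_map (primrec_tableElement hL hN hu) ?_) (const [])
  exact primrec_tableWord.comp (hL.comp fst)
    (nat_mod.comp (nat_sub.comp (hN.comp fst) snd) (hN.comp fst))

theorem primrec_tableStep {A : α → GenericAlgorithm} {c : α → Config} {coin : α → Bool}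
    (hL : Primrec L) (hN : Primrec N) (hA : Primrec A) (hc : Primrec c) (hcoin : Primrec coin) :
    Primrec fun a => tableStep (L a) (N a) (A a) (c a) (coin a) := by
  have hs : Primrec fun a => (c a).state := Config.primrec_state.comp hc
  have hw (j : ℕ) : Primrec fun a => (c a).string j := Config.primrec_string.comp hc (const j)
  refine Primrec.ite (PrimrecRel.comp Primrec.eq hs (const 1))
    (Config.primrec_answer.comp hc (primrec_tableAdd hL hN (hw 2) (hw 3)))
    (Primrec.ite (PrimrecRel.comp Primrec.eq hs (const 2))
    (Config.primrec_answer.comp hc (primrec_tableInv hL hN (hw 2)))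
    (option_getD.comp (option_map (primrec_find?
      (GenericAlgorithm.primrec_rules.comp hA) ?_)
      (Config.primrec_apply.comp (hc.comp fst) snd)) hc))
  exact ((PrimrecRel.comp Primrec.eq (Rule.primrec_state.comp snd) (hs.comp fst)).and
    ((PrimrecRel.comp Primrec.eq (Rule.primrec_coin.comp snd) (hcoin.comp fst)).and
      (PrimrecRel.comp Primrec.eq (Rule.primrec_read.comp snd)
        (list_map (Config.primrec_tapes.comp (hc.comp fst))
          (Tape.primrec_scan.comp snd).to₂)))).decide

end Composition

/-- The input tape for a Diffie–Hellman instance in `ℤ_p`, where `p` is prime. -/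
def tableInput (L : List (List Bool)) (p x y : ℕ) : List ℕ :=
  p.bits.reverse.map Tape.bitSymbol ++ [4] ++ (p.bits.reverse.map Tape.bitSymbol ++ [3]) ++ [4]
    ++ [tableWord L 1, tableWord L x, tableWord L y].flatMap fun w =>
      w.map Tape.bitSymbol ++ [3]

theorem tableInput_table {p : ℕ} (hp : p.Prime) (x y : ℕ) :
    tableInput (table σ) p x y = GenericAlgorithm.inputSymbols p (cdhInstance σ x y) := by
  rw [tableInput, tableWord_table, inputSymbols_prime hp, cdhInstance]

theorem primrec_tableInput {α : Type*} [Primcodable α] {L : α → List (List Bool)} {p x y : α → ℕ}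
    (hL : Primrec L) (hp : Primrec p) (hx : Primrec x) (hy : Primrec y) :
    Primrec fun a => tableInput (L a) (p a) (x a) (y a) := by
  have hb : Primrec fun w : List Bool => w.map Tape.bitSymbol :=
    list_map Primrec.id (Tape.primrec_bitSymbol.comp snd).to₂
  have hp : Primrec fun a => (p a).bits.reverse.map Tape.bitSymbol :=
    hb.comp (list_reverse.comp (primrec_bits.comp hp))
  refine list_append.comp (list_append.comp (list_append.comp (list_append.comp hp (const [4]))
    (list_append.comp hp (const [3]))) (const [4])) (list_flatMap
      (list_cons.comp (primrec_tableWord.comp hL (const 1))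
        (list_cons.comp (primrec_tableWord.comp hL hx)
          (list_cons.comp (primrec_tableWord.comp hL hy) (const [])))) ?_)
  exact list_append.comp (hb.comp snd) (const [3])

/-- All lists of `t` coins. -/
def coinLists : ℕ → List (List Bool)
  | 0 => [[]]
  | t + 1 => (coinLists t).flatMap fun l => [false :: l, true :: l]

theorem primrec_coinLists : Primrec coinLists := by
  have h : Primrec₂ fun (_ : ℕ) (ls : List (List Bool)) =>
      ls.flatMap fun l => [false :: l, true :: l] :=
    list_flatMap snd (list_cons.comp (list_cons.comp (const false) snd)
      (list_cons.comp (list_cons.comp (const true) snd) (const [])))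
  refine (nat_rec₁ [[]] h).of_eq fun t => ?_
  induction t with
  | zero => rfl
  | succ t ih => rw [coinLists, ← ih]

theorem sum_coinLists (t : ℕ) (f : List Bool → ℕ) :
    ((coinLists t).map f).sum = ∑ r : Fin t → Bool, f (List.ofFn r) := by
  induction t generalizing f with
  | zero => simp [coinLists]
  | succ t ih =>
    rw [← (Fin.consEquiv fun _ => Bool).sum_comp, Fintype.sum_prod_type, Fintype.sum_bool,
      ← Finset.sum_add_distrib]
    have := ih fun l => f (false :: l) + f (true :: l)
    simp only [Fin.consEquiv, Equiv.coe_fn_mk, List.ofFn_cons]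
    rw [coinLists, List.map_flatMap, List.flatMap_def, List.sum_flatten, List.map_map]
    simp only [add_comm (f (true :: _))]
    rw [← this]
    congr 2

/-- `1` if the algorithm `A`, run with the coins `r` on the Diffie–Hellman instance `x, y` in
`ℤ_p`, succeeds, and `0` otherwise. -/
def tableSuccess (L : List (List Bool)) (p : ℕ) (A : GenericAlgorithm) (x y : ℕ) (r : List Bool) :
    ℕ :=
  if (r.foldl (tableStep L p A) (A.initial (tableInput L p x y))).string 1
    = tableWord L (x * y % p) then 1 else 0

theorem primrec_tableSuccess {α : Type*} [Primcodable α] {L : α → List (List Bool)}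
    {p x y : α → ℕ} {A : α → GenericAlgorithm} {r : α → List Bool} (hL : Primrec L)
    (hp : Primrec p) (hA : Primrec A) (hx : Primrec x) (hy : Primrec y) (hr : Primrec r) :
    Primrec fun a => tableSuccess (L a) (p a) (A a) (x a) (y a) (r a) := by
  have hi : Primrec fun a => (A a).initial (tableInput (L a) (p a) (x a) (y a)) :=
    GenericAlgorithm.primrec_initial.comp hA (primrec_tableInput hL hp hx hy)
  have hs : Primrec₂ fun (a : α) (s : Config × Bool) => tableStep (L a) (p a) (A a) s.1 s.2 :=
    primrec_tableStep (hL.comp fst) (hp.comp fst) (hA.comp fst) (fst.comp snd) (snd.comp snd)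
  have hf : Primrec fun a => (r a).foldl (tableStep (L a) (p a) (A a))
      ((A a).initial (tableInput (L a) (p a) (x a) (y a))) :=
    list_foldl hr hi hs
  exact Primrec.ite (PrimrecRel.comp Primrec.eq (Config.primrec_string.comp hf (const 1))
    (primrec_tableWord.comp hL (nat_mod.comp (nat_mul.comp hx hy) hp))) (const 1) (const 0)

/-- `successCount` in terms of a table. -/
def tableCount (L : List (List Bool)) (n t : ℕ) (A : GenericAlgorithm) : ℕ :=
  ∑ p ∈ Finset.range (2 ^ n), if 2 ^ (n - 1) ≤ p ∧ p.Prime then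
    ∑ x ∈ Finset.range p, ∑ y ∈ Finset.range p,
      ((coinLists t).map (tableSuccess L p A x y)).sum else 0

theorem bitPrimes_eq (n : ℕ) :
    bitPrimes n = {p ∈ Finset.range (2 ^ n) | 2 ^ (n - 1) ≤ p ∧ p.Prime} := by
  ext p
  simp only [mem_bitPrimes, Finset.mem_filter, Finset.mem_range]
  tauto

theorem tableCount_table (t : ℕ) (A : GenericAlgorithm) :
    tableCount (table σ) n t A = successCount A t σ := by
  rw [tableCount, successCount, bitPrimes_eq, Finset.sum_filter]
  refine Finset.sum_congr rfl fun p _ => ?_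
  split_ifs with hp
  · refine Finset.sum_congr rfl fun x _ => Finset.sum_congr rfl fun y _ => ?_
    rw [sum_coinLists, Finset.card_filter]
    refine Finset.sum_congr rfl fun r _ => ?_
    rw [tableSuccess, tableStep_table, tableInput_table σ hp.2, tableWord_table]
    rfl
  · rfl

theorem primrecRel_bitPrime : PrimrecRel fun n p : ℕ => 2 ^ (n - 1) ≤ p ∧ p.Prime :=
  (PrimrecRel.comp nat_le (primrec_pow.comp (const 2) (nat_sub.comp fst (const 1))) snd).and
    (primrecPred_prime.comp snd)

theorem primrec_card_bitPrimes : Primrec fun n => (bitPrimes n).card := by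
  refine (primrec_sum_range (primrec_pow.comp (const 2) Primrec.id)
    (Primrec.ite primrecRel_bitPrime (const 1) (const 0)).to₂).of_eq fun n => ?_
  rw [bitPrimes_eq, Finset.card_filter]
  rfl

theorem primrec_tableCount {α : Type*} [Primcodable α] {L : α → List (List Bool)} {n t : α → ℕ}
    {A : α → GenericAlgorithm} (hL : Primrec L) (hn : Primrec n) (ht : Primrec t)
    (hA : Primrec A) : Primrec fun a => tableCount (L a) (n a) (t a) (A a) := by
  have hr : Primrec₂ fun (z : ((α × ℕ) × ℕ) × ℕ) (r : List Bool) =>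
      tableSuccess (L z.1.1.1) z.1.1.2 (A z.1.1.1) z.1.2 z.2 r :=
    have ha : Primrec fun z : (((α × ℕ) × ℕ) × ℕ) × List Bool => z.1.1.1.1 :=
      fst.comp (fst.comp (fst.comp fst))
    primrec_tableSuccess (hL.comp ha) (snd.comp (fst.comp (fst.comp fst))) (hA.comp ha)
      (snd.comp (fst.comp fst)) (snd.comp fst) snd
  have ht : Primrec fun z : ((α × ℕ) × ℕ) × ℕ => coinLists (t z.1.1.1) :=
    primrec_coinLists.comp (ht.comp (fst.comp (fst.comp fst)))
  have hy : Primrec₂ fun (z : α × ℕ) (x : ℕ) => ∑ y ∈ Finset.range z.2,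
        ((coinLists (t z.1)).map (tableSuccess (L z.1) z.2 (A z.1) x y)).sum :=
    primrec_sum_range (snd.comp fst) (primrec_sum_map ht hr)
  have hp : PrimrecPred fun z : α × ℕ => 2 ^ (n z.1 - 1) ≤ z.2 ∧ z.2.Prime :=
    primrecRel_bitPrime.comp (hn.comp fst) snd
  exact primrec_sum_range (primrec_pow.comp (const 2) hn)
    (Primrec.ite hp (primrec_sum_range snd hy) (const 0))

end Tables

/-! ### Search for a resistant encoding function -/

section Search

open Primrec

/-- `L` is the table of an encoding function into `n` bitstrings. -/
def IsTable (n : ℕ) (L : List (List Bool)) : Prop :=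
  L.length = 2 ^ n ∧ ∀ x < 2 ^ n,
    (tableWord L x).length = n ∧ tableElement L (2 ^ n) (tableWord L x) = some x

/-- `Resists` in terms of a table, for the algorithm with code `a`, if it is taken into account. -/
def TableResists (a n : ℕ) (L : List (List Bool)) : Prop :=
  ∀ q : ℕ × ℕ × GenericAlgorithm, Encodable.decode a = some q → threshold q.1 q.2.1 a ≤ n →
    tableCount L n (instanceTime q.1 n) q.2.2 * (4 * n ^ q.2.1)
      ≤ 4 ^ n * 2 ^ instanceTime q.1 n * (bitPrimes n).card

theorem isTable_table {n : ℕ} (σ : EncodingFunction n) : IsTable n (table σ) := by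
  refine ⟨by simp [table], fun x hx => ?_⟩
  rw [tableElement_table, tableWord_table]
  refine ⟨length_word σ hx, ?_⟩
  have := elementOf_word σ (2 ^ n) le_rfl ⟨x, hx⟩
  rwa [if_pos hx] at this

theorem IsTable.exists_eq {n : ℕ} {L : List (List Bool)} (h : IsTable n L) :
    ∃ σ : EncodingFunction n, table σ = L := by
  obtain ⟨hlen, hL⟩ := h
  let f (x : Fin (2 ^ n)) : List.Vector Bool n := ⟨tableWord L x, (hL x x.2).1⟩
  have hf : Function.Injective f := fun x y e => by
    have e' : tableWord L x = tableWord L y := congrArg List.Vector.toList e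
    have hx := (hL x x.2).2
    rw [e', (hL y y.2).2] at hx
    exact Fin.ext (Option.some.inj hx).symm
  let σ : EncodingFunction n :=
    Equiv.ofBijective f ((Fintype.bijective_iff_injective_and_card f).2 ⟨hf, by simp⟩)
  refine ⟨σ, List.ext_getElem (by simp [table, hlen]) fun x h1 h2 => ?_⟩
  have hx : x < 2 ^ n := hlen ▸ h2
  have : (σ ⟨x, hx⟩).toList = tableWord L x := rfl
  simp [table, word, hx, this, tableWord, List.getD, h2]

theorem primrecRel_isTable : PrimrecRel IsTable := by
  have hpow {α : Type} [Primcodable α] {n : α → ℕ} (hn : Primrec n) :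
      Primrec fun a => 2 ^ n a := primrec_pow.comp (const 2) hn
  have hR : PrimrecRel fun (x : ℕ) (q : ℕ × List (List Bool)) =>
      (tableWord q.2 x).length = q.1 ∧
        tableElement q.2 (2 ^ q.1) (tableWord q.2 x) = some x := by
    have hw : Primrec fun z : ℕ × ℕ × List (List Bool) => tableWord z.2.2 z.1 :=
      primrec_tableWord.comp (snd.comp snd) fst
    exact (PrimrecRel.comp Primrec.eq (list_length.comp hw) (fst.comp snd)).and
      (PrimrecRel.comp Primrec.eq
        (primrec_tableElement (snd.comp snd) (hpow (fst.comp snd)) hw) (option_some.comp fst))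
  have h := primrecRel_forall_lt hR
  exact (PrimrecRel.comp Primrec.eq (list_length.comp snd) (hpow fst)).and
    (h.comp (hpow fst) Primrec.id)

theorem primrec_instanceTime : Primrec₂ instanceTime :=
  nat_add.comp (primrec_pow.comp (nat_add.comp (nat_mul.comp (const 5) snd) (const 6)) fst) fst

theorem primrec_threshold : Primrec fun q : ℕ × ℕ × ℕ => threshold q.1 q.2.1 q.2.2 :=
  nat_add.comp (primrec_pow.comp (const 4) (nat_add.comp (nat_add.comp
    (nat_mul.comp (const 4) fst) (fst.comp snd)) (const 7))) (snd.comp snd)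

theorem primrecRel_tableResists :
    PrimrecRel fun (a : ℕ) (q : ℕ × List (List Bool)) => TableResists a q.1 q.2 := by
  classical
  have hn : Primrec fun z : (ℕ × ℕ × List (List Bool)) × ℕ × ℕ × GenericAlgorithm => z.1.2.1 :=
    fst.comp (snd.comp fst)
  have hd : Primrec fun z : (ℕ × ℕ × List (List Bool)) × ℕ × ℕ × GenericAlgorithm => z.2.2.1 :=
    fst.comp (snd.comp snd)
  have ht : Primrec fun z : (ℕ × ℕ × List (List Bool)) × ℕ × ℕ × GenericAlgorithm =>
      instanceTime z.2.1 z.1.2.1 := primrec_instanceTime.comp (fst.comp snd) hn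
  have hthr : PrimrecPred fun z : (ℕ × ℕ × List (List Bool)) × ℕ × ℕ × GenericAlgorithm =>
      ¬ threshold z.2.1 z.2.2.1 z.1.1 ≤ z.1.2.1 :=
    (PrimrecRel.comp nat_le (primrec_threshold.comp (Primrec.pair (fst.comp snd)
      (Primrec.pair hd (fst.comp fst)))) hn).not
  have hle : PrimrecPred fun z : (ℕ × ℕ × List (List Bool)) × ℕ × ℕ × GenericAlgorithm =>
      tableCount z.1.2.2 z.1.2.1 (instanceTime z.2.1 z.1.2.1) z.2.2.2 * (4 * z.1.2.1 ^ z.2.2.1)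
        ≤ 4 ^ z.1.2.1 * 2 ^ instanceTime z.2.1 z.1.2.1 * (bitPrimes z.1.2.1).card :=
    PrimrecRel.comp nat_le
      (nat_mul.comp (primrec_tableCount (snd.comp (snd.comp fst)) hn ht (snd.comp (snd.comp snd)))
        (nat_mul.comp (const 4) (primrec_pow.comp hn hd)))
      (nat_mul.comp (nat_mul.comp (primrec_pow.comp (const 4) hn) (primrec_pow.comp (const 2) ht))
        (primrec_card_bitPrimes.comp hn))
  have h := option_casesOn (Primrec.decode.comp (fst (α := ℕ) (β := ℕ × List (List Bool))))
    (const true) (hthr.or hle).decide.to₂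
  refine Primrec.primrecPred (h.of_eq fun z => ?_)
  rw [eq_comm, ← Bool.coe_iff_coe, decide_eq_true_iff]
  dsimp only
  unfold TableResists
  cases (Encodable.decode z.1 : Option (ℕ × ℕ × GenericAlgorithm)) with
  | none => simp
  | some q => 
    simp only [Option.some.injEq, decide_eq_true_iff, ← imp_iff_not_or]
    exact ⟨fun h => h q rfl, fun h q' e => e ▸ h⟩

/-- The encoding functions that resist all algorithms can be found by a search. -/
theorem exists_computable_resists : ∃ σ : ∀ n, EncodingFunction n,
    (Computable fun n => table (σ n)) ∧ ∀ n, ∀ a < n, ∀ q : ℕ × ℕ × GenericAlgorithm,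
      Encodable.decode a = some q → threshold q.1 q.2.1 a ≤ n →
        Resists (σ n) q.1 q.2.1 q.2.2 := by
  have hR : PrimrecRel fun (n : ℕ) (L : List (List Bool)) =>
      IsTable n L ∧ ∀ a < n, TableResists a n L := by
    have h := primrecRel_forall_lt primrecRel_tableResists
    exact (primrecRel_isTable.comp fst snd).and (h.comp fst Primrec.id)
  obtain ⟨T, hT, hRT⟩ := exists_computable_of_primrecRel hR fun n => by
    obtain ⟨σ, hσ⟩ := exists_resists n
    refine ⟨table σ, isTable_table σ, fun a ha q hq hqn => ?_⟩
    rw [tableCount_table]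
    exact hσ a ha q hq hqn
  choose σ hσ using fun n => (hRT n).1.exists_eq
  refine ⟨σ, hT.of_eq fun n => (hσ n).symm, fun n a ha q hq hqn => ?_⟩
  have := (hRT n).2 a ha q hq hqn
  rwa [← hσ, tableCount_table] at this

end Search

end GenericGroup

theorem theorem9p3 (M : ℕ → GenericGroup.GenericAlgorithm)
    (hM : GenericGroup.IsRecursiveEnumeration M) :
    ∃ σ : GenericGroup.EncodingFamily,
      GenericGroup.IsComputableFamily σ ∧ GenericGroup.CDHEffectivelyHard M σ := by
  open GenericGroup in
  obtain ⟨σ, hσ, hres⟩ := exists_computable_resists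
  refine ⟨fun n => σ n, ⟨fun n x => tableWord (table (σ n)) x,
    primrec_tableWord.to_comp.comp (hσ.comp .fst) .snd, fun n x => ?_⟩, ?_⟩
  · dsimp only
    rw [tableWord_table, word_val]
  · let code (i d : ℕ) : ℕ := Encodable.encode (i, d, M i)
    have hcode : Computable fun q : ℕ × ℕ => code q.1 q.2 :=
      Computable.encode.comp (.pair .fst (.pair .snd (hM.1.comp .fst)))
    have hthr := primrec_threshold.to_comp.comp (Computable.pair .fst (Computable.pair .snd hcode))
    refine ⟨fun i d => threshold i d (code i d) + 1, Computable.succ.comp hthr,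
      fun i d n hn => cdhProb_le n.pos ?_⟩
    refine hres n (code i d) ?_ (i, d, M i) (Encodable.encodek _) (Nat.le_of_succ_le hn)
    exact (Nat.le_add_left _ _).trans_lt hn
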